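/- **Setting.** Let $\{0,1\}^\star$ be the set of finite words over $\{0,1\}$, $|u|$ the length of $u$, and write $u\le v$ (for $v$ a finite or infinite word) if $u$ is an initial segment of $v$. Let $\mathbf S$ be the set of finite rooted binary trees: non-empty finite sets $\mathbf s\subset\{0,1\}^\star$ that contain $u$ whenever they contain $u0$ or $u1$. Write $\#\mathbf s(u)=\#\{v\in\mathbf s: u\le v\}$ and let $e=\{\emptyset\}$ be the tree consisting of the root only. *BST process.* The Markov chain on $\mathbf S$ which at each step picks uniformly at random one of the words outside the current tree whose parent is in the tree, and adjoins it. Let $P$ be its transition matrix. *DST process.* Given an initial tree $\mathbf w\in\mathbf S$ and independent random infinite words $V^1,V^2,\dots$, each distributed according to the fair coin-tossing measure $\mu$ on $\{0,1\}^\infty$, put $W_0=\mathbf w$ and let $W_{n+1}$ be $W_n$ together with the shortest initial segment of $V^{n+1}$ that is not in $W_n$. Let $Q(\mathbf s,\mathbf t)$ be the probability that inserting one such random word into $\mathbf s$ in this way gives $\mathbf t$. *Doob–Martin theory.* For a transition matrix $R$ on a countable set $E$ with reference state $e$, put $G(i,j)=\sum_{n\ge0}R^n(i,j)$, where $0<G(e,j)<\infty$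 for all $j$ is required, and $K_R(i,j)=G(i,j)/G(e,j)$. The Doob–Martin compactification is the closure $\bar E$ of $\{K_R(\cdot,j):j\in E\}$ in $\mathbb R^E$, together with the map $j\mapsto K_R(\cdot,j)$ from $E$ to $\bar E$; the boundary $\partial E$ is $\bar E$ minus the image of $E$, and the extended Martin kernel is $K_R(i,y)=y(i)$ for $y\in\bar E$. A function $f\ge0$ is excessive if $Rf\le f$ and regular if $Rf=f$. A regular function $h$ with $h(e)=1$ is extremal if it is an extreme point of the convex set of excessive functions $f$ with $f(e)=1$. The Doob $h$-transform of $R$ is the transition matrix $h(i)^{-1}R(i,j)h(j)$ on $\{i:h(i)>0\}$. A boundary point $y\in\partial\mathbf S$ of the BST process is identified with the probability measure $\nu$ on $\{0,1\}^\infty$ if the following holds: a sequence $(\mathbf t_n)$ in $\mathbf S$ converges to $y$ if and only if $\#\mathbf t_n\to\infty$ and $\#\mathbf t_n(u)/\#\mathbf t_n\to\nu\{v: u\le v\}$ for every $u\in\{0,1\}^\star$. **Theorem 5.1.** $P$ and $Q$ are transition matrices on $\mathbf S$ for which $e$ is a reference state, and the DST process, for every initial tree, is a Markov chain with transition matrix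 $Q$. Let $$h(\mathbf s)=(\#\mathbf s)!\prod_{u\in\mathbf s}2^{-|u|},\qquad \mathbf s\in\mathbf S.$$ 1. The function $h$ is regular for $P$ and strictly positive, and the DST process is the Doob $h$-transform of the BST process: $Q(\mathbf s,\mathbf t)=h(\mathbf s)^{-1}P(\mathbf s,\mathbf t)h(\mathbf t)$ for all $\mathbf s,\mathbf t\in\mathbf S$. 2. The regular function $h$ is extremal for $P$. 3. The function $h$ is a point of the Doob–Martin boundary $\partial\mathbf S$ of the BST process (that is, $h=K_P(\cdot,y)$ for a boundary point $y$), namely the boundary point identified with the fair coin-tossing measure $\mu$. 4. The DST and BST processes have the same Doob–Martin compactification: there is a homeomorphism from the compactification for $P$ onto that for $Q$ which carries $K_P(\cdot,\mathbf t)$ to $K_Q(\cdot,\mathbf t)$ for every $\mathbf t\in\mathbf S$. -/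

import Mathlib

open MeasureTheory ProbabilityTheory Filter Topology
open scoped ENNReal Nat

noncomputable section

/-! ### Markov chains on a countable set and Doob–Martin theory -/

section MarkovChain

variable {E : Type*}

/-- `P` is a transition matrix on `E`: nonnegative entries, rows summing to one. -/
def IsTransitionMatrix (P : E → E → ℝ) : Prop :=
  (∀ i j, 0 ≤ P i j) ∧ ∀ i, HasSum (P i) 1

/-- The process `X` is a Markov chain (time index `0, 1, 2, …`) with transition matrix `P`. -/
structure IsMarkovChain {Ω : Type*} [MeasurableSpace Ω] (Pr : Measure Ω)
    (X : ℕ → Ω → E) (P : E → E → ℝ) : Prop where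
  measurableSet_eq : ∀ n i, MeasurableSet {ω | X n ω = i}
  step : ∀ (n : ℕ) (x : ℕ → E),
    Pr.real {ω | ∀ k ≤ n + 1, X k ω = x k} =
      Pr.real {ω | ∀ k ≤ n, X k ω = x k} * P (x n) (x (n + 1))

open Classical in
/-- The `n`-step transition matrix `Pⁿ`, with entries in `[0, ∞]`. -/
def stepPow (P : E → E → ℝ) : ℕ → E → E → ℝ≥0∞
  | 0, i, j => if i = j then 1 else 0
  | n + 1, i, j => ∑' k, ENNReal.ofReal (P i k) * stepPow P n k j

/-- The Green kernel `G(i, j) = ∑ₙ Pⁿ(i, j)`. -/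
def greenKernel (P : E → E → ℝ) (i j : E) : ℝ≥0∞ :=
  ∑' n, stepPow P n i j

/-- `e` is a reference state: `0 < G(e, j) < ∞` for all `j`. -/
def IsReferenceState (P : E → E → ℝ) (e : E) : Prop :=
  ∀ j, 0 < greenKernel P e j ∧ greenKernel P e j < ∞

/-- The Martin kernel `K(i, j) = G(i, j) / G(e, j)`. -/
def martinKernel (P : E → E → ℝ) (e i j : E) : ℝ :=
  (greenKernel P i j / greenKernel P e j).toReal

/-- Excessive (nonnegative superharmonic) functions. The sum is taken in `[0, ∞]`. -/
def IsExcessiveFun (P : E → E → ℝ) (f : E → ℝ) : Prop :=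
  (∀ i, 0 ≤ f i) ∧ ∀ i, ∑' j, ENNReal.ofReal (P i j * f j) ≤ ENNReal.ofReal (f i)

/-- Regular (nonnegative harmonic) functions. The sum is taken in `[0, ∞]`. -/
def IsRegularFun (P : E → E → ℝ) (f : E → ℝ) : Prop :=
  (∀ i, 0 ≤ f i) ∧ ∀ i, ∑' j, ENNReal.ofReal (P i j * f j) = ENNReal.ofReal (f i)

/-- The convex set of excessive functions taking the value `1` at the reference state. -/
def normalizedExcessive (P : E → E → ℝ) (e : E) : Set (E → ℝ) :=
  {f | IsExcessiveFun P f ∧ f e = 1}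

/-- `f` is extremal: an extreme point of the set of normalized excessive functions. -/
def IsExtremalFun (P : E → E → ℝ) (e : E) (f : E → ℝ) : Prop :=
  f ∈ Set.extremePoints ℝ (normalizedExcessive P e)

/-- The Doob–Martin compactification: the closure of the functions `K(·, j)` in the product
space `ℝ^E`. The extended Martin kernel at a point `y` of it is `K(i, y) = y i`. -/
def martinCompactification (P : E → E → ℝ) (e : E) : Set (E → ℝ) :=
  closure (Set.range fun j i => martinKernel P e i j)

/-- The canonical map `j ↦ K(·, j)` of `E` into its Doob–Martin compactification. -/
def martinEmbed (P : E → E → ℝ) (e : E) (j : E) : martinCompactification P e :=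
  ⟨fun i => martinKernel P e i j, subset_closure ⟨j, rfl⟩⟩

/-- The Doob–Martin boundary: the compactification minus the image of `E`. -/
def martinBoundary (P : E → E → ℝ) (e : E) : Set (E → ℝ) :=
  martinCompactification P e \ Set.range fun j i => martinKernel P e i j

/-- The transition matrix of the Doob `h`-transform, on the state space `{i | 0 < h i}`. -/
def doobTransform (P : E → E → ℝ) (h : E → ℝ) (i j : {i : E // 0 < h i}) : ℝ :=
  (h i)⁻¹ * P i j * h j

/-- Two transition matrices on `E` (with the same reference state) have the same Doob–Martin
compactification: there is a homeomorphism of compactifications which is the identity on `E`. -/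
def SameMartinCompactification (P Q : E → E → ℝ) (e : E) : Prop :=
  ∃ Ψ : martinCompactification P e ≃ₜ martinCompactification Q e,
    ∀ j, Ψ (martinEmbed P e j) = martinEmbed Q e j

end MarkovChain

/-! ### Finite rooted binary trees -/

/-- Finite rooted binary trees: nonempty finite sets of words over `{0, 1}` (`false` is `0`,
`true` is `1`) which contain with each word `u b` its parent `u`. -/
@[ext] structure BinTree where
  verts : Finset (List Bool)
  nonempty : verts.Nonempty
  parent_mem : ∀ (u : List Bool) (b : Bool), u ++ [b] ∈ verts → u ∈ verts

/-- The tree whose only vertex is the root (the empty word). -/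
def rootTree : BinTree where
  verts := {[]}
  nonempty := ⟨[], by simp⟩
  parent_mem := by simp

/-- Number of vertices. -/
def BinTree.size (s : BinTree) : ℕ := s.verts.card

/-- `#s(u)`: the number of vertices of `s` having `u` as an initial segment. -/
def BinTree.sizeAt (s : BinTree) (u : List Bool) : ℕ := (s.verts.filter fun v => u <+: v).card

/-- External vertices: words outside the tree whose parent is in the tree. -/
def BinTree.external (s : BinTree) : Finset (List Bool) :=
  (s.verts.biUnion fun u => {u ++ [false], u ++ [true]}) \ s.verts

/-- Transition matrix of the binary search tree process: an external vertex is picked uniformly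
at random and adjoined to the tree. -/
def bstMatrix (s t : BinTree) : ℝ :=
  ((s.external.filter fun v => insert v s.verts = t.verts).card : ℝ) / s.external.card

/-- The initial segment of length `k` of an infinite word. -/
def wordPrefix (x : ℕ → Bool) (k : ℕ) : List Bool := (List.range k).map x

/-- The set of infinite words having `u` as an initial segment. -/
def cylinderAt (u : List Bool) : Set (ℕ → Bool) := {x | wordPrefix x u.length = u}

/-- The fair coin-tossing measure on `{0, 1}^∞`. -/
def coinMeasure : Measure (ℕ → Bool) :=
  Measure.infinitePi fun _ => (PMF.uniformOfFintype Bool).toMeasure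

theorem BinTree.nil_mem (s : BinTree) : [] ∈ s.verts := by
  obtain ⟨u, hu⟩ := s.nonempty
  induction u using List.reverseRecOn with
  | nil => exact hu
  | append_singleton u b ih => exact ih (s.parent_mem u b hu)

theorem BinTree.exists_free (s : BinTree) (x : ℕ → Bool) : ∃ k, wordPrefix x k ∉ s.verts := by
  by_contra! hc
  refine Set.infinite_of_injective_forall_mem (s := (s.verts : Set (List Bool)))
    (f := wordPrefix x) ?_ hc s.verts.finite_toSet
  intro a b hab
  simpa [wordPrefix] using congrArg List.length hab

/-- The depth of the first unoccupied vertex met by a particle following the infinite word `x`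
down from the root of the complete binary tree. -/
def BinTree.freeDepth (s : BinTree) (x : ℕ → Bool) : ℕ := Nat.find (s.exists_free x)

theorem wordPrefix_succ (x : ℕ → Bool) (k : ℕ) :
    wordPrefix x (k + 1) = wordPrefix x k ++ [x k] := by
  simp [wordPrefix, List.range_succ]

/-- One step of the digital search tree algorithm: the input `x` starts at the root, moves from an
occupied vertex of depth `k` to its left or right child according to the digit `x k` (digits are
numbered from `0`), and stays at the first unoccupied vertex. -/
def BinTree.dstInsert (s : BinTree) (x : ℕ → Bool) : BinTree where
  verts := insert (wordPrefix x (s.freeDepth x)) s.verts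
  nonempty := Finset.insert_nonempty _ _
  parent_mem := by
    intro u b hub
    rcases Finset.mem_insert.1 hub with h | h
    · refine Finset.mem_insert_of_mem ?_
      cases hk : s.freeDepth x with
      | zero => simp [hk, wordPrefix] at h
      | succ k =>
        rw [hk, wordPrefix_succ] at h
        have hu : u = wordPrefix x k := (List.append_inj' h rfl).1
        have hlt : k < Nat.find (s.exists_free x) := by
          rw [← BinTree.freeDepth, hk]; exact Nat.lt_succ_self k
        rw [hu]
        exact not_not.1 (Nat.find_min (s.exists_free x) hlt)
    · exact Finset.mem_insert_of_mem (s.parent_mem u b h)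

/-- One-step transition matrix of the digital search tree process: the law of the result of
inserting one fair coin-tossing sequence. -/
def dstMatrix (s t : BinTree) : ℝ := coinMeasure.real {x | s.dstInsert x = t}

/-- `X` is the digital search tree process with initial tree `w`: successive independent fair
coin-tossing sequences are inserted by the digital search tree algorithm. -/
def IsDSTProcess {Ω : Type*} [MeasurableSpace Ω] (Pr : Measure Ω) (w : BinTree)
    (X : ℕ → Ω → BinTree) : Prop :=
  ∃ V : ℕ → Ω → (ℕ → Bool),
    (∀ n, Measurable (V n)) ∧ iIndepFun V Pr ∧ (∀ n, Pr.map (V n) = coinMeasure) ∧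
    (∀ ω, X 0 ω = w) ∧ ∀ n ω, X (n + 1) ω = (X n ω).dstInsert (V n ω)

/-- `y` is the point of the Doob–Martin boundary of the binary search tree process identified with
the measure `μ` on `{0, 1}^∞`: a sequence of trees `tₙ` converges to `y` in the
compactification if and only if `#tₙ → ∞` and `#tₙ(u) / #tₙ → μ {x | u < x}` for all words `u`. -/
def IsBSTBoundaryPoint (y : BinTree → ℝ) (μ : Measure (ℕ → Bool)) : Prop :=
  y ∈ martinBoundary bstMatrix rootTree ∧
  ∀ t : ℕ → BinTree,
    Tendsto (fun n => (martinEmbed bstMatrix rootTree (t n) : BinTree → ℝ)) atTop (𝓝 y) ↔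
      Tendsto (fun n => (t n).size) atTop atTop ∧
      ∀ u : List Bool, Tendsto (fun n => ((t n).sizeAt u : ℝ) / (t n).size) atTop
        (𝓝 (μ.real (cylinderAt u)))

/-- The function `h(s) = (#s)! ∏_{u ∈ s} 2^{-|u|}`. -/
def dstFun (s : BinTree) : ℝ := (s.size ! : ℝ) * ∏ u ∈ s.verts, ((2 : ℝ) ^ u.length)⁻¹

end

/-! ### Growing a binary tree -/

namespace BinTree

/-! Both chains grow a tree `s` by one external vertex `v`: the BST chain with weight `1/(#s + 1)`,
the DST chain with weight `2^{-|v|}`, since the cylinders of the external vertices partition the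
infinite words. Adjoining `v` multiplies `h` by `(#s + 1) 2^{-|v|}`, the ratio of these weights.
Hence DST is the `h`-transform of BST, and regularity of `h` says that the DST weights sum to one. A
transform rescales `K(i, ·)` by the constant `h(e)/h(i)`, so the compactifications agree up to a
scaling of coordinates (`sameMartinCompactification_of_doob`).

The BST kernel is explicit (`martinKernel_bstMatrix`): `K(s,t)` equals `(#s)! ∏_{u ∈ s} #t(u)` over
the falling factorial of `#t` of order `#s`. As `#t → ∞` this behaves like `(#s)! ∏_{u ∈ s}
#t(u)/#t`, which tends to `h(s)` when the relative subtree sizes tend to `2^{-|u|}`; conversely,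
quotients of kernels at `s` and `s ∪ {u}` recover the relative subtree sizes.

The remaining input is `tendsto_growthOp_iterate_abs_martinKernel`: for DST trees `W_n` started at
the root, `E|K(s, W_n) - h(s)| → 0`. It follows from a second moment bound for a martingale close to
the subtree size at `u`. It yields trees whose kernels approximate `h`, so `h` lies in the closure.
It also yields extremality: a regular `f ≤ C h` with `f(e) = 1` satisfies `f(s) = E[K(s, W_n)
g(W_n)]` with `g = f/h` bounded by `C` and of mean one, so `f(s) = h(s)` in the limit
(`eq_dstFun_of_isRegularFun_of_le`). These expectations are iterates of the operator `growthOp`; no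
path space is needed. -/

theorem verts_injective : Function.Injective BinTree.verts := fun _ _ => BinTree.ext

instance : Countable BinTree := verts_injective.countable

theorem mem_of_prefix (s : BinTree) {u v : List Bool} (huv : u <+: v) (hv : v ∈ s.verts) :
    u ∈ s.verts := by
  obtain ⟨w, rfl⟩ := huv
  induction w using List.reverseRecOn with
  | nil => simpa using hv
  | append_singleton w b ih => exact ih (s.parent_mem (u ++ w) b (by simpa using hv))

theorem mem_external {s : BinTree} {v : List Bool} :
    v ∈ s.external ↔ v ∉ s.verts ∧ ∃ u ∈ s.verts, ∃ b, v = u ++ [b] := by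
  simp [external, and_comm]

theorem notMem_of_mem_external {s : BinTree} {v : List Bool} (hv : v ∈ s.external) :
    v ∉ s.verts := (mem_external.1 hv).1

/-- A proper initial segment of an external vertex belongs to the tree. -/
theorem mem_of_prefix_external {s : BinTree} {u v : List Bool} (hv : v ∈ s.external)
    (huv : u <+: v) (hne : u ≠ v) : u ∈ s.verts := by
  obtain ⟨-, w, hw, b, rfl⟩ := mem_external.1 hv
  rcases List.prefix_concat_iff.1 huv with h | h
  · exact absurd h hne
  · exact s.mem_of_prefix h hw

/-- Two comparable external vertices are equal. -/
theorem external_eq_of_prefix {s : BinTree} {u v : List Bool} (hu : u ∈ s.external)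
    (hv : v ∈ s.external) (huv : u <+: v) : u = v := by
  by_contra hne
  exact notMem_of_mem_external hu (mem_of_prefix_external hv huv hne)

theorem exists_external_prefix {s : BinTree} {w : List Bool} (hw : w ∉ s.verts) :
    ∃ v ∈ s.external, v <+: w := by
  induction w using List.reverseRecOn with
  | nil => exact absurd s.nil_mem hw
  | append_singleton w b ih =>
    by_cases h : w ∈ s.verts
    · exact ⟨w ++ [b], mem_external.2 ⟨hw, w, h, b, rfl⟩, List.prefix_rfl⟩
    · obtain ⟨v, hv, hvw⟩ := ih h
      exact ⟨v, hv, hvw.trans (List.prefix_append _ _)⟩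

theorem external_prefix_unique {s : BinTree} {u v w : List Bool} (hu : u ∈ s.external)
    (hv : v ∈ s.external) (huw : u <+: w) (hvw : v <+: w) : u = v := by
  rcases List.prefix_or_prefix_of_prefix huw hvw with h | h
  · exact external_eq_of_prefix hu hv h
  · exact (external_eq_of_prefix hv hu h).symm

theorem size_pos (s : BinTree) : 0 < s.size := Finset.card_pos.2 s.nonempty

/-- A tree with `n` vertices has `n + 1` external vertices. -/
theorem card_external (s : BinTree) : s.external.card = s.size + 1 := by
  classical
  -- The `n` vertices have `2n` distinct children, and those inside the tree are exactly the `n - 1`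
  -- vertices other than the root.
  have hchild : (s.verts.biUnion fun u => ({u ++ [false], u ++ [true]} : Finset (List Bool))).card
      = s.size * 2 := by
    rw [Finset.card_biUnion]
    · simp [size]
    · intro u _ v _ huv
      rw [Function.onFun, Finset.disjoint_left]
      intro w hw hw'
      simp only [Finset.mem_insert, Finset.mem_singleton] at hw hw'
      rcases hw with rfl | rfl <;> rcases hw' with h | h <;>
        exact huv (List.append_inj' h rfl).1
  have hinter : s.verts ∩ (s.verts.biUnion fun u => {u ++ [false], u ++ [true]})
      = s.verts.erase [] := by
    ext w
    simp only [Finset.mem_inter, Finset.mem_biUnion, Finset.mem_insert, Finset.mem_singleton,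
      Finset.mem_erase]
    constructor
    · rintro ⟨hw, u, -, rfl | rfl⟩ <;> simp [hw]
    · rintro ⟨hne, hw⟩
      refine ⟨hw, ?_⟩
      rcases List.eq_nil_or_concat w with rfl | ⟨u, b, rfl⟩
      · exact absurd rfl hne
      · rw [List.concat_eq_append] at hw ⊢
        refine ⟨u, s.parent_mem u b hw, ?_⟩
        cases b <;> simp
  have h1 := s.size_pos
  rw [external, Finset.card_sdiff, hchild, hinter, Finset.card_erase_of_mem s.nil_mem]
  change s.size * 2 - (s.size - 1) = _
  omega

/-- The tree obtained by adjoining the external vertex `v` (and `s` itself for other `v`). -/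
def adjoin (s : BinTree) (v : List Bool) : BinTree where
  verts := if v ∈ s.external then insert v s.verts else s.verts
  nonempty := by split_ifs <;> simp [s.nonempty]
  parent_mem := by
    intro u b h
    split_ifs at h ⊢ with hv
    · rcases Finset.mem_insert.1 h with h | h
      · refine Finset.mem_insert_of_mem (mem_of_prefix_external hv (h ▸ List.prefix_append _ _) ?_)
        rintro rfl
        simpa using congrArg List.length h
      · exact Finset.mem_insert_of_mem (s.parent_mem u b h)
    · exact s.parent_mem u b h

theorem verts_adjoin {s : BinTree} {v : List Bool} (hv : v ∈ s.external) :
    (s.adjoin v).verts = insert v s.verts := by simp [adjoin, hv]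

theorem size_adjoin {s : BinTree} {v : List Bool} (hv : v ∈ s.external) :
    (s.adjoin v).size = s.size + 1 := by
  rw [size, verts_adjoin hv, Finset.card_insert_of_notMem (notMem_of_mem_external hv), size]

theorem insert_eq_verts_iff {s t : BinTree} {v : List Bool} (hv : v ∈ s.external) :
    insert v s.verts = t.verts ↔ s.adjoin v = t := by
  rw [← verts_adjoin hv, verts_injective.eq_iff]

theorem sizeAt_pos {t : BinTree} {u : List Bool} (hu : u ∈ t.verts) : 0 < t.sizeAt u :=
  Finset.card_pos.2 ⟨u, by simp [hu]⟩

theorem sizeAt_eq_zero {t : BinTree} {u : List Bool} (hu : u ∉ t.verts) : t.sizeAt u = 0 := by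
  rw [sizeAt, Finset.card_eq_zero, Finset.filter_eq_empty_iff]
  exact fun v hv huv => hu (t.mem_of_prefix huv hv)

theorem sizeAt_nil (t : BinTree) : t.sizeAt [] = t.size := by simp [sizeAt, size]

theorem sizeAt_le_size (t : BinTree) (u : List Bool) : t.sizeAt u ≤ t.size :=
  Finset.card_filter_le _ _

/-- The vertices of `t` outside a subtree `s` are counted by their ancestor outside `s` that is
closest to the root. -/
theorem sum_sizeAt_external {s t : BinTree} (hst : s.verts ⊆ t.verts) :
    ∑ v ∈ s.external, t.sizeAt v + s.size = t.size := by
  classical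
  have hdisj : (s.external : Set (List Bool)).PairwiseDisjoint
      fun v => t.verts.filter fun w => v <+: w := by
    intro u hu v hv huv
    rw [Function.onFun, Finset.disjoint_left]
    intro w hw hw'
    exact huv (external_prefix_unique hu hv (Finset.mem_filter.1 hw).2 (Finset.mem_filter.1 hw').2)
  have hunion : (s.external.biUnion fun v => t.verts.filter fun w => v <+: w)
      = t.verts \ s.verts := by
    ext w
    simp only [Finset.mem_biUnion, Finset.mem_filter, Finset.mem_sdiff]
    constructor
    · rintro ⟨v, hv, hw, hvw⟩
      exact ⟨hw, fun h => notMem_of_mem_external hv (s.mem_of_prefix hvw h)⟩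
    · rintro ⟨hw, hws⟩
      obtain ⟨v, hv, hvw⟩ := exists_external_prefix hws
      exact ⟨v, hv, hw, hvw⟩
  have h := Finset.card_sdiff_add_card_eq_card hst
  rw [← hunion, Finset.card_biUnion hdisj] at h
  exact h

end BinTree

/-! ### Cylinders and coin tossing -/

theorem length_wordPrefix (x : ℕ → Bool) (k : ℕ) : (wordPrefix x k).length = k := by
  simp [wordPrefix]

theorem wordPrefix_prefix (x : ℕ → Bool) {k l : ℕ} (h : k ≤ l) :
    wordPrefix x k <+: wordPrefix x l := by
  induction l, h using Nat.le_induction with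
  | base => exact List.prefix_rfl
  | succ l _ ih => exact ih.trans (wordPrefix_succ x l ▸ List.prefix_append _ _)

theorem mem_cylinderAt_iff_exists {x : ℕ → Bool} {u : List Bool} :
    x ∈ cylinderAt u ↔ ∃ k, wordPrefix x k = u := by
  constructor
  · exact fun h => ⟨_, h⟩
  · rintro ⟨k, rfl⟩
    simp [cylinderAt, length_wordPrefix]

/-- Puts cylinders in the finite box form required by the product measure formula. The default
`false` is never read, as only indices below `u.length` occur. -/
theorem cylinderAt_eq_pi (u : List Bool) :
    cylinderAt u = (Finset.range u.length : Set ℕ).pi fun i => {u.getD i false} := by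
  ext x
  simp only [cylinderAt, Set.mem_ofPred_eq, Set.mem_pi, Finset.coe_range, Set.mem_Iio,
    Set.mem_singleton_iff]
  constructor
  · intro h i hi
    rw [← h]
    simp [wordPrefix, List.getD, hi]
  · intro h
    refine List.ext_getElem (length_wordPrefix _ _) fun i _ hi => ?_
    simp [wordPrefix, h i hi, hi]

theorem measurableSet_cylinderAt (u : List Bool) : MeasurableSet (cylinderAt u) := by
  rw [cylinderAt_eq_pi]
  exact MeasurableSet.pi (Finset.countable_toSet _) fun _ _ => measurableSet_singleton _

instance : IsProbabilityMeasure coinMeasure := by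
  unfold coinMeasure
  infer_instance

theorem coinMeasure_real_cylinderAt (u : List Bool) :
    coinMeasure.real (cylinderAt u) = ((2 : ℝ) ^ u.length)⁻¹ := by
  rw [Measure.real, cylinderAt_eq_pi, coinMeasure, Measure.infinitePi_pi]
  · simp
  · exact fun _ _ => measurableSet_singleton _

theorem cylinderAt_nil : cylinderAt [] = Set.univ := by
  ext x; simp [cylinderAt, wordPrefix]

theorem cylinderAt_subset {u v : List Bool} (h : u <+: v) : cylinderAt v ⊆ cylinderAt u := by
  rintro x hx
  obtain ⟨k, rfl⟩ := mem_cylinderAt_iff_exists.1 hx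
  have hk : u.length ≤ k := by simpa [length_wordPrefix] using h.length_le
  rcases List.prefix_or_prefix_of_prefix h (wordPrefix_prefix x hk) with h' | h'
  · exact (h'.eq_of_length (length_wordPrefix _ _).symm).symm
  · exact h'.eq_of_length (length_wordPrefix _ _)

theorem prefix_or_prefix_of_mem_cylinderAt {x : ℕ → Bool} {u v : List Bool}
    (hu : x ∈ cylinderAt u) (hv : x ∈ cylinderAt v) : u <+: v ∨ v <+: u := by
  obtain ⟨k, rfl⟩ := mem_cylinderAt_iff_exists.1 hu
  obtain ⟨l, rfl⟩ := mem_cylinderAt_iff_exists.1 hv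
  exact (le_total k l).imp (wordPrefix_prefix x) (wordPrefix_prefix x)

namespace BinTree

theorem pairwiseDisjoint_cylinderAt (s : BinTree) :
    (s.external : Set (List Bool)).PairwiseDisjoint cylinderAt := by
  intro u hu v hv huv
  rw [Function.onFun, Set.disjoint_left]
  intro x hx hx'
  rcases prefix_or_prefix_of_mem_cylinderAt hx hx' with h | h
  · exact huv (external_eq_of_prefix hu hv h)
  · exact huv (external_eq_of_prefix hv hu h).symm

theorem freeDepth_mem_external (s : BinTree) (x : ℕ → Bool) :
    wordPrefix x (s.freeDepth x) ∈ s.external := by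
  have hspec : wordPrefix x (s.freeDepth x) ∉ s.verts := Nat.find_spec (s.exists_free x)
  refine mem_external.2 ⟨hspec, ?_⟩
  obtain ⟨k, hk⟩ : ∃ k, s.freeDepth x = k + 1 := by
    refine Nat.exists_eq_succ_of_ne_zero fun h => hspec ?_
    rw [h]
    exact s.nil_mem
  refine ⟨wordPrefix x k, not_not.1 (Nat.find_min (s.exists_free x) ?_), x k, ?_⟩
  · rw [← freeDepth, hk]
    exact k.lt_succ_self
  · rw [hk, wordPrefix_succ]

theorem biUnion_cylinderAt (s : BinTree) : ⋃ v ∈ s.external, cylinderAt v = Set.univ := by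
  refine Set.eq_univ_of_forall fun x => Set.mem_biUnion (s.freeDepth_mem_external x) ?_
  exact mem_cylinderAt_iff_exists.2 ⟨_, rfl⟩

/-- The vertex where the particle stops and `v` are both external, and both of their cylinders
contain `x`; cylinders of distinct external vertices are disjoint. -/
theorem dstInsert_eq_adjoin {s : BinTree} {v : List Bool} (hv : v ∈ s.external) {x : ℕ → Bool}
    (hx : x ∈ cylinderAt v) : s.dstInsert x = s.adjoin v := by
  have hf := s.freeDepth_mem_external x
  have : wordPrefix x (s.freeDepth x) = v := by
    by_contra hne
    exact Set.disjoint_left.1 (s.pairwiseDisjoint_cylinderAt hf hv hne)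
      (mem_cylinderAt_iff_exists.2 ⟨_, rfl⟩) hx
  apply BinTree.ext
  rw [verts_adjoin hv, ← this]
  rfl

/-- The external vertices partition every cylinder. -/
theorem sum_coinMeasure_inter (s : BinTree) (u : List Bool) :
    ∑ v ∈ s.external, coinMeasure.real (cylinderAt v ∩ cylinderAt u)
      = ((2 : ℝ) ^ u.length)⁻¹ := by
  rw [← measureReal_biUnion_finset, ← Set.iUnion₂_inter, biUnion_cylinderAt, Set.univ_inter,
    coinMeasure_real_cylinderAt]
  · exact fun v hv w hw hvw => (s.pairwiseDisjoint_cylinderAt hv hw hvw).mono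
      Set.inter_subset_left Set.inter_subset_left
  · exact fun v _ => (measurableSet_cylinderAt v).inter (measurableSet_cylinderAt u)

/-- Equality in Kraft's inequality for the external vertices. -/
theorem sum_external_weight (s : BinTree) :
    ∑ v ∈ s.external, ((2 : ℝ) ^ v.length)⁻¹ = 1 := by
  simpa [cylinderAt_nil, coinMeasure_real_cylinderAt] using s.sum_coinMeasure_inter []

theorem setOf_dstInsert_eq (s t : BinTree) :
    {x | s.dstInsert x = t} = ⋃ v ∈ s.external.filter (fun v => insert v s.verts = t.verts),
      cylinderAt v := by
  ext x
  simp only [Set.mem_ofPred_eq, Finset.mem_filter, Set.mem_iUnion, exists_prop]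
  constructor
  · intro h
    exact ⟨_, ⟨s.freeDepth_mem_external x, by rw [← h]; rfl⟩,
      mem_cylinderAt_iff_exists.2 ⟨_, rfl⟩⟩
  · rintro ⟨v, ⟨hv, hvt⟩, hx⟩
    rw [dstInsert_eq_adjoin hv hx]
    exact (insert_eq_verts_iff hv).1 hvt

theorem measurableSet_dstInsert_eq (s t : BinTree) : MeasurableSet {x | s.dstInsert x = t} := by
  rw [setOf_dstInsert_eq]
  exact Finset.measurableSet_biUnion _ fun v _ => measurableSet_cylinderAt v

end BinTree

theorem dstMatrix_eq_sum (s t : BinTree) : dstMatrix s t =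
    ∑ v ∈ s.external.filter (fun v => insert v s.verts = t.verts), ((2 : ℝ) ^ v.length)⁻¹ := by
  rw [dstMatrix, BinTree.setOf_dstInsert_eq, measureReal_biUnion_finset]
  · simp_rw [coinMeasure_real_cylinderAt]
  · exact s.pairwiseDisjoint_cylinderAt.subset fun v hv => (Finset.mem_filter.1 hv).1
  · exact fun v _ => measurableSet_cylinderAt v

/-! ### The digital search tree process as a Markov chain -/

/-- Along a prescribed path from `w`, the `k`-th transition is an event of `V k` alone, so
independence turns path probabilities into products of one-step probabilities. -/
theorem IsDSTProcess.isMarkovChain {Ω : Type*} [MeasurableSpace Ω] {Pr : Measure Ω}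
    [IsProbabilityMeasure Pr] {w : BinTree} {X : ℕ → Ω → BinTree} (h : IsDSTProcess Pr w X) :
    IsMarkovChain Pr X dstMatrix := by
  classical
  obtain ⟨V, hV, hind, hlaw, hX0, hX⟩ := h
  have hset : ∀ n (x : ℕ → BinTree), x 0 = w → {ω | ∀ k ≤ n, X k ω = x k} =
      ⋂ k ∈ Finset.range n, V k ⁻¹' {y | (x k).dstInsert y = x (k + 1)} := by
    intro n x hx
    ext ω
    simp only [Set.mem_ofPred_eq, Set.mem_iInter, Finset.mem_range, Set.mem_preimage]
    constructor
    · intro h k hk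
      rw [← h k hk.le, ← hX, h (k + 1) hk]
    · intro h k
      induction k with
      | zero => intro _; rw [hX0, hx]
      | succ k ih => intro hk; rw [hX, ih (by omega), h k (by omega)]
  have hprob : ∀ n (x : ℕ → BinTree), x 0 = w → Pr.real {ω | ∀ k ≤ n, X k ω = x k} =
      ∏ k ∈ Finset.range n, dstMatrix (x k) (x (k + 1)) := by
    intro n x hx
    rw [hset n x hx, Measure.real, hind.measure_inter_preimage_eq_mul _
      (fun k _ => BinTree.measurableSet_dstInsert_eq _ _), ENNReal.toReal_prod]
    refine Finset.prod_congr rfl fun k _ => ?_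
    rw [dstMatrix, Measure.real, ← hlaw k,
      Measure.map_apply (hV k) (BinTree.measurableSet_dstInsert_eq _ _)]
  refine ⟨fun n => ?_, fun n x => ?_⟩
  · induction n with
    | zero => intro i; simp [hX0]
    | succ n ih =>
      intro i
      have : {ω | X (n + 1) ω = i} =
          ⋃ j, {ω | X n ω = j} ∩ V n ⁻¹' {y | j.dstInsert y = i} := by
        ext ω
        simp [hX]
      rw [this]
      exact MeasurableSet.iUnion fun j =>
        (ih j).inter (hV n (BinTree.measurableSet_dstInsert_eq _ _))
  · by_cases hx : x 0 = w
    · rw [hprob _ x hx, hprob _ x hx, Finset.prod_range_succ]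
    -- A path not starting at `w` has probability zero, so both sides vanish.
    · have : ∀ m, {ω | ∀ k ≤ m, X k ω = x k} = ∅ := by
        refine fun m => Set.eq_empty_of_forall_notMem fun ω hω => hx ?_
        rw [← hω 0 m.zero_le, hX0]
      simp [this]

/-! ### Chains that grow by one vertex at a time -/

/-- The matrix of the chain that adjoins the external vertex `v` to `s` with weight `c s v`. -/
def growthMatrix (c : BinTree → List Bool → ℝ) (s t : BinTree) : ℝ :=
  ∑ v ∈ s.external.filter (fun v => insert v s.verts = t.verts), c s v

/-- The action of `growthMatrix c` on functions. -/
def growthOp (c : BinTree → List Bool → ℝ) (F : BinTree → ℝ) (s : BinTree) : ℝ :=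
  ∑ v ∈ s.external, c s v * F (s.adjoin v)

/-- The growth weights of the binary search tree process. -/
noncomputable def bstWeight (s : BinTree) (_ : List Bool) : ℝ := ((s.size : ℝ) + 1)⁻¹

/-- The growth weights of the digital search tree process. -/
noncomputable def dstWeight (_ : BinTree) (v : List Bool) : ℝ := ((2 : ℝ) ^ v.length)⁻¹

theorem bstWeight_pos (s : BinTree) (v : List Bool) : 0 < bstWeight s v := by
  unfold bstWeight; positivity

theorem dstWeight_pos (s : BinTree) (v : List Bool) : 0 < dstWeight s v := by
  unfold dstWeight; positivity

theorem bstMatrix_eq_growthMatrix : bstMatrix = growthMatrix bstWeight := by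
  funext s t
  simp [bstMatrix, growthMatrix, bstWeight, s.card_external, div_eq_mul_inv]

theorem dstMatrix_eq_growthMatrix : dstMatrix = growthMatrix dstWeight := by
  funext s t
  simp [dstMatrix_eq_sum, growthMatrix, dstWeight]

theorem sum_bstWeight (s : BinTree) : ∑ v ∈ s.external, bstWeight s v = 1 := by
  have : (s.size : ℝ) + 1 ≠ 0 := by positivity
  simp [bstWeight, s.card_external, this]

section GrowthOperator

variable {c : BinTree → List Bool → ℝ}

theorem growthMatrix_nonneg (hc : ∀ s v, 0 ≤ c s v) (s t : BinTree) : 0 ≤ growthMatrix c s t :=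
  Finset.sum_nonneg fun _ _ => hc _ _

/-- Each external vertex leads to exactly one tree, so the sum over all trees collapses to a finite
one. -/
theorem tsum_growthMatrix_mul (hc : ∀ s v, 0 ≤ c s v) (F : BinTree → ℝ≥0∞) (s : BinTree) :
    ∑' t, ENNReal.ofReal (growthMatrix c s t) * F t =
      ∑ v ∈ s.external, ENNReal.ofReal (c s v) * F (s.adjoin v) := by
  have h : ∀ t, ENNReal.ofReal (growthMatrix c s t) * F t = ∑ v ∈ s.external,
      if insert v s.verts = t.verts then ENNReal.ofReal (c s v) * F t else 0 := by
    intro t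
    rw [growthMatrix, ENNReal.ofReal_sum_of_nonneg fun _ _ => hc _ _, Finset.sum_mul,
      Finset.sum_filter]
  simp_rw [h]
  rw [Summable.tsum_finsetSum fun _ _ => ENNReal.summable]
  refine Finset.sum_congr rfl fun v hv => ?_
  rw [tsum_eq_single (s.adjoin v) fun t ht =>
    if_neg fun h => ht ((BinTree.insert_eq_verts_iff hv).1 h).symm]
  exact if_pos ((BinTree.insert_eq_verts_iff hv).2 rfl)

theorem tsum_growthMatrix (hc : ∀ s v, 0 ≤ c s v) {F : BinTree → ℝ} (hF : ∀ s, 0 ≤ F s)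
    (s : BinTree) : ∑' t, ENNReal.ofReal (growthMatrix c s t * F t) =
      ENNReal.ofReal (growthOp c F s) := by
  simp_rw [ENNReal.ofReal_mul (growthMatrix_nonneg hc s _)]
  rw [tsum_growthMatrix_mul hc, growthOp,
    ENNReal.ofReal_sum_of_nonneg fun _ _ => mul_nonneg (hc _ _) (hF _)]
  simp_rw [ENNReal.ofReal_mul (hc _ _)]

theorem growthOp_nonneg (hc : ∀ s v, 0 ≤ c s v) {F : BinTree → ℝ} (hF : ∀ s, 0 ≤ F s)
    (s : BinTree) : 0 ≤ growthOp c F s :=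
  Finset.sum_nonneg fun _ _ => mul_nonneg (hc _ _) (hF _)

theorem isTransitionMatrix_growthMatrix (hc : ∀ s v, 0 ≤ c s v)
    (hsum : ∀ s : BinTree, ∑ v ∈ s.external, c s v = 1) : IsTransitionMatrix (growthMatrix c) := by
  refine ⟨growthMatrix_nonneg hc, fun s => ?_⟩
  have h := tsum_growthMatrix hc (F := fun _ => 1) (fun _ => zero_le_one) s
  simp only [mul_one, growthOp, hsum, ENNReal.ofReal_one] at h
  have hs : Summable (growthMatrix c s) := by
    refine (ENNReal.summable_toReal (h.trans_ne ENNReal.one_ne_top)).congr fun t => ?_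
    exact ENNReal.toReal_ofReal (growthMatrix_nonneg hc s t)
  rw [← ENNReal.ofReal_tsum_of_nonneg (growthMatrix_nonneg hc s) hs, ENNReal.ofReal_eq_one] at h
  exact h ▸ hs.hasSum

theorem isExcessiveFun_growthMatrix_iff (hc : ∀ s v, 0 ≤ c s v) {F : BinTree → ℝ} :
    IsExcessiveFun (growthMatrix c) F ↔ (∀ s, 0 ≤ F s) ∧ ∀ s, growthOp c F s ≤ F s := by
  refine and_congr_right fun hF => forall_congr' fun s => ?_
  rw [tsum_growthMatrix hc hF, ENNReal.ofReal_le_ofReal_iff (hF s)]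

theorem isRegularFun_growthMatrix_iff (hc : ∀ s v, 0 ≤ c s v) {F : BinTree → ℝ} :
    IsRegularFun (growthMatrix c) F ↔ (∀ s, 0 ≤ F s) ∧ ∀ s, growthOp c F s = F s := by
  refine and_congr_right fun hF => forall_congr' fun s => ?_
  rw [tsum_growthMatrix hc hF, ENNReal.ofReal_eq_ofReal_iff (growthOp_nonneg hc hF s) (hF s)]

theorem growthOp_iterate_nonneg (hc : ∀ s v, 0 ≤ c s v) {F : BinTree → ℝ} (hF : ∀ s, 0 ≤ F s)
    (n : ℕ) (s : BinTree) : 0 ≤ (growthOp c)^[n] F s := by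
  induction n generalizing s with
  | zero => exact hF s
  | succ n ih =>
    rw [Function.iterate_succ_apply']
    exact growthOp_nonneg hc ih s

/-- Identifies `(growthOp c)^[n] F s` as the mean of `F` after `n` steps from `s`. -/
theorem tsum_stepPow_growthMatrix (hc : ∀ s v, 0 ≤ c s v) {F : BinTree → ℝ} (hF : ∀ s, 0 ≤ F s)
    (n : ℕ) (s : BinTree) : ∑' t, stepPow (growthMatrix c) n s t * ENNReal.ofReal (F t) =
      ENNReal.ofReal ((growthOp c)^[n] F s) := by
  induction n generalizing s with
  | zero =>
    rw [tsum_eq_single s fun t ht => by simp [stepPow, ht.symm]]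
    simp [stepPow]
  | succ n ih =>
    simp_rw [stepPow, ← ENNReal.tsum_mul_right]
    rw [ENNReal.tsum_comm]
    simp_rw [mul_assoc, ENNReal.tsum_mul_left, ih]
    rw [Function.iterate_succ_apply', ← tsum_growthMatrix hc (growthOp_iterate_nonneg hc hF n)]
    simp_rw [ENNReal.ofReal_mul (growthMatrix_nonneg hc s _)]

/-- Only the values on trees with `#s + n` vertices enter the `n`-th iterate at `s`. -/
theorem growthOp_iterate_mono (hc : ∀ s v, 0 ≤ c s v) {F G : BinTree → ℝ} {n : ℕ} {s : BinTree}
    (h : ∀ t : BinTree, t.size = s.size + n → F t ≤ G t) :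
    (growthOp c)^[n] F s ≤ (growthOp c)^[n] G s := by
  induction n generalizing s with
  | zero => exact h s rfl
  | succ n ih =>
    simp only [Function.iterate_succ_apply']
    refine Finset.sum_le_sum fun v hv => mul_le_mul_of_nonneg_left (ih fun t ht => h t ?_) (hc _ _)
    rw [ht, BinTree.size_adjoin hv]
    omega

theorem growthOp_iterate_const_mul (a : ℝ) (F : BinTree → ℝ) (n : ℕ) (s : BinTree) :
    (growthOp c)^[n] (fun t => a * F t) s = a * (growthOp c)^[n] F s := by
  induction n generalizing s with
  | zero => rfl
  | succ n ih =>
    simp only [Function.iterate_succ_apply', growthOp, ih, Finset.mul_sum]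
    exact Finset.sum_congr rfl fun v _ => by ring

theorem growthOp_iterate_add (F G : BinTree → ℝ) (n : ℕ) (s : BinTree) :
    (growthOp c)^[n] (fun t => F t + G t) s =
      (growthOp c)^[n] F s + (growthOp c)^[n] G s := by
  induction n generalizing s with
  | zero => rfl
  | succ n ih =>
    simp only [Function.iterate_succ_apply', growthOp, ih, ← Finset.sum_add_distrib, mul_add]

theorem growthOp_iterate_sum {ι : Type*} (I : Finset ι) (F : ι → BinTree → ℝ) (n : ℕ)
    (s : BinTree) : (growthOp c)^[n] (fun t => ∑ i ∈ I, F i t) s =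
      ∑ i ∈ I, (growthOp c)^[n] (F i) s := by
  induction n generalizing s with
  | zero => rfl
  | succ n ih =>
    simp only [Function.iterate_succ_apply', growthOp, ih, Finset.mul_sum]
    exact Finset.sum_comm

theorem growthOp_iterate_const (hsum : ∀ s : BinTree, ∑ v ∈ s.external, c s v = 1) (a : ℝ) (n : ℕ)
    (s : BinTree) : (growthOp c)^[n] (fun _ => a) s = a := by
  induction n generalizing s with
  | zero => rfl
  | succ n ih =>
    simp only [Function.iterate_succ_apply', growthOp, ih, ← Finset.sum_mul, hsum, one_mul]

theorem growthOp_iterate_of_fixed {F : BinTree → ℝ} (hF : ∀ s, growthOp c F s = F s) (n : ℕ) :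
    (growthOp c)^[n] F = F :=
  Function.iterate_fixed (funext hF) n

end GrowthOperator

/-! ### The Green kernel of the binary search tree process -/

/-- The probability that the binary search tree process started at `s` passes through `t`. -/
noncomputable def hitProb (s t : BinTree) : ℝ :=
  if s.verts ⊆ t.verts then
    ((s.size)! : ℝ) * (t.size - s.size)! / ((t.size)! * ∏ u ∈ t.verts \ s.verts, (t.sizeAt u : ℝ))
  else 0

theorem hitProb_pos {s t : BinTree} (h : s.verts ⊆ t.verts) : 0 < hitProb s t := by
  have : 0 < ∏ u ∈ t.verts \ s.verts, (t.sizeAt u : ℝ) :=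
    Finset.prod_pos fun u hu => Nat.cast_pos.2 (BinTree.sizeAt_pos (Finset.mem_sdiff.1 hu).1)
  rw [hitProb, if_pos h]
  positivity

theorem hitProb_nonneg (s t : BinTree) : 0 ≤ hitProb s t := by
  by_cases h : s.verts ⊆ t.verts
  · exact (hitProb_pos h).le
  · rw [hitProb, if_neg h]

/-- First-step analysis: adjoining `v` removes the factor `#t(v)` from the denominator, so `v`
contributes proportionally to `#t(v)`. These counts add up to `#t - #s`, which is the factor missing
from `(#t - #s - 1)!`. -/
theorem growthOp_hitProb {s t : BinTree} (hlt : s.size < t.size) :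
    growthOp bstWeight (fun r => hitProb r t) s = hitProb s t := by
  by_cases h : s.verts ⊆ t.verts
  · have hne : ∀ u ∈ t.verts, (t.sizeAt u : ℝ) ≠ 0 := fun u hu =>
      Nat.cast_ne_zero.2 (BinTree.sizeAt_pos hu).ne'
    have hprod : ∏ u ∈ t.verts \ s.verts, (t.sizeAt u : ℝ) ≠ 0 :=
      Finset.prod_ne_zero_iff.2 fun u hu => hne u (Finset.mem_sdiff.1 hu).1
    obtain ⟨n, hn⟩ : ∃ n, t.size = s.size + 1 + n := ⟨_, (Nat.add_sub_cancel' hlt).symm⟩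
    have hterm : ∀ v ∈ s.external, bstWeight s v * hitProb (s.adjoin v) t =
        ((s.size)! : ℝ) * n ! / ((t.size)! * ∏ u ∈ t.verts \ s.verts, (t.sizeAt u : ℝ))
          * t.sizeAt v := by
      intro v hv
      by_cases hvt : v ∈ t.verts
      · have hsub : (s.adjoin v).verts ⊆ t.verts := by
          rw [BinTree.verts_adjoin hv]
          exact Finset.insert_subset hvt h
        have hmem : v ∈ t.verts \ s.verts :=
          Finset.mem_sdiff.2 ⟨hvt, BinTree.notMem_of_mem_external hv⟩
        have hsplit := Finset.mul_prod_erase _ (fun u => (t.sizeAt u : ℝ)) hmem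
        rw [← Finset.sdiff_insert,
          ← BinTree.verts_adjoin hv] at hsplit
        rw [← hsplit] at hprod ⊢
        have hv0 := left_ne_zero_of_mul hprod
        have hp0 := right_ne_zero_of_mul hprod
        rw [hitProb, if_pos hsub, BinTree.size_adjoin hv, hn, Nat.add_sub_cancel_left, bstWeight,
          Nat.factorial_succ]
        push_cast
        field_simp
      · have hsub : ¬ (s.adjoin v).verts ⊆ t.verts := fun hs =>
          hvt (hs (by simp [BinTree.verts_adjoin hv]))
        simp [hitProb, hsub, BinTree.sizeAt_eq_zero hvt]
    have hsum : ∑ v ∈ s.external, (t.sizeAt v : ℝ) = n + 1 := by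
      have := BinTree.sum_sizeAt_external h
      rw [← Nat.cast_sum]
      norm_cast
      omega
    rw [growthOp, Finset.sum_congr rfl hterm, ← Finset.mul_sum, hsum, hitProb, if_pos h]
    have : t.size - s.size = n + 1 := by omega
    rw [this, Nat.factorial_succ]
    push_cast
    ring
  · rw [hitProb, if_neg h]
    refine Finset.sum_eq_zero fun v hv => ?_
    have hsub : ¬ (s.adjoin v).verts ⊆ t.verts := fun hs =>
      h (fun u hu => hs (by simp [BinTree.verts_adjoin hv, hu]))
    simp [hitProb, hsub]

open Classical in
theorem hitProb_of_size_eq {s t : BinTree} (h : t.size = s.size) :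
    hitProb s t = if s = t then 1 else 0 := by
  split_ifs with hst
  · subst hst
    simp [hitProb, Nat.factorial_ne_zero]
  · rw [hitProb, if_neg]
    exact fun hsub => hst (BinTree.ext (Finset.eq_of_subset_of_card_le hsub h.le))

/-- Each step adds exactly one vertex, so `t` can be visited only at time `#t - #s` and the Green
kernel reduces to a single term. -/
theorem stepPow_bstMatrix (n : ℕ) (s t : BinTree) : stepPow bstMatrix n s t =
    if t.size = s.size + n then ENNReal.ofReal (hitProb s t) else 0 := by
  rw [bstMatrix_eq_growthMatrix]
  have hc : ∀ s v, 0 ≤ bstWeight s v := fun s v => (bstWeight_pos s v).le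
  induction n generalizing s with
  | zero =>
    by_cases h : t.size = s.size
    · rw [stepPow, add_zero, if_pos h, hitProb_of_size_eq h]
      by_cases hst : s = t
      · rw [if_pos hst, if_pos hst, ENNReal.ofReal_one]
      · rw [if_neg hst, if_neg hst, ENNReal.ofReal_zero]
    · have hst : s ≠ t := by
        rintro rfl
        exact h rfl
      rw [stepPow, add_zero, if_neg hst, if_neg h]
  | succ n ih =>
    simp_rw [stepPow, ih]
    rw [tsum_growthMatrix_mul hc]
    have hsize : ∀ v ∈ s.external, (t.size = (s.adjoin v).size + n ↔ t.size = s.size + (n + 1)) :=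
      fun v hv => by rw [BinTree.size_adjoin hv]; omega
    split_ifs with h
    · rw [← growthOp_hitProb (s := s) (t := t) (by omega), growthOp,
        ENNReal.ofReal_sum_of_nonneg fun _ _ => mul_nonneg (hc _ _) (hitProb_nonneg _ _)]
      refine Finset.sum_congr rfl fun v hv => ?_
      rw [if_pos ((hsize v hv).2 h), ENNReal.ofReal_mul (hc _ _)]
    · refine Finset.sum_eq_zero fun v hv => ?_
      rw [if_neg fun h' => h ((hsize v hv).1 h'), mul_zero]

theorem greenKernel_bstMatrix (s t : BinTree) :
    greenKernel bstMatrix s t = ENNReal.ofReal (hitProb s t) := by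
  simp_rw [greenKernel, stepPow_bstMatrix]
  by_cases h : s.verts ⊆ t.verts
  · have hle : s.size ≤ t.size := Finset.card_le_card h
    rw [tsum_eq_single (t.size - s.size)]
    · exact if_pos (by omega)
    · exact fun n hn => if_neg (by omega)
  · simp [hitProb, h]

theorem rootTree_subset (t : BinTree) : rootTree.verts ⊆ t.verts := by
  simp [rootTree, t.nil_mem]

theorem size_rootTree : rootTree.size = 1 := rfl

/-- The Martin kernel of the binary search tree process in closed form. -/
theorem martinKernel_bstMatrix (s t : BinTree) : martinKernel bstMatrix rootTree s t =
    (s.size)! * (∏ u ∈ s.verts, (t.sizeAt u : ℝ)) / (t.size.descFactorial s.size : ℝ) := by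
  rw [martinKernel, greenKernel_bstMatrix, greenKernel_bstMatrix, ENNReal.toReal_div,
    ENNReal.toReal_ofReal (hitProb_nonneg _ _), ENNReal.toReal_ofReal (hitProb_nonneg _ _)]
  by_cases h : s.verts ⊆ t.verts
  · have hne : ∀ r : BinTree, ∏ u ∈ t.verts \ r.verts, (t.sizeAt u : ℝ) ≠ 0 := fun r =>
      Finset.prod_ne_zero_iff.2 fun u hu =>
        Nat.cast_ne_zero.2 (BinTree.sizeAt_pos (Finset.mem_sdiff.1 hu).1).ne'
    have h1 := Finset.prod_sdiff (f := fun u => (t.sizeAt u : ℝ)) h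
    have h2 := Finset.prod_sdiff (f := fun u => (t.sizeAt u : ℝ)) (rootTree_subset t)
    have h3 : ∏ u ∈ rootTree.verts, (t.sizeAt u : ℝ) = t.size := by
      simp [rootTree, BinTree.sizeAt_nil]
    have hle : s.size ≤ t.size := Finset.card_le_card h
    have h4 : ((t.size - s.size)! : ℝ) * t.size.descFactorial s.size = (t.size)! := by
      exact_mod_cast Nat.factorial_mul_descFactorial hle
    have h5 : (t.size : ℝ) * (t.size - 1)! = (t.size)! := by
      exact_mod_cast Nat.mul_factorial_pred t.size_pos.ne'
    have hd : (t.size.descFactorial s.size : ℝ) ≠ 0 :=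
      Nat.cast_ne_zero.2 (Nat.descFactorial_pos.2 hle).ne'
    rw [h3, ← h1] at h2
    have hs := hne s
    have hr := hne rootTree
    have hf : ((t.size - 1)! : ℝ) ≠ 0 := Nat.cast_ne_zero.2 (Nat.factorial_ne_zero _)
    have ht : ((t.size)! : ℝ) ≠ 0 := Nat.cast_ne_zero.2 (Nat.factorial_ne_zero _)
    rw [hitProb, if_pos h, hitProb, if_pos (rootTree_subset t), size_rootTree]
    rw [div_div_div_eq, div_eq_div_iff (by simp [hs, hf, ht]) hd]
    simp only [Nat.factorial_one, Nat.cast_one, one_mul]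
    have hN : (t.size : ℝ) ≠ 0 := Nat.cast_ne_zero.2 t.size_pos.ne'
    -- The extra factor `#t` turns `(#t - 1)!` into `(#t)!` through `h5`.
    apply mul_right_cancel₀ hN
    linear_combination
      ((s.size)! : ℝ) * (t.size - s.size)! * (t.size)! * t.size.descFactorial s.size * h2
        + ((s.size)! : ℝ) * (t.size)! * (∏ u ∈ s.verts, (t.sizeAt u : ℝ)) *
          (∏ u ∈ t.verts \ s.verts, (t.sizeAt u : ℝ)) * (h4 - h5)
  -- A vertex of `s` outside `t` has `#t(u) = 0`, so the closed form vanishes together with the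
  -- hitting probability.
  · obtain ⟨u, hus, hut⟩ := Finset.not_subset.1 h
    rw [hitProb, if_neg h, Finset.prod_eq_zero hus (by simp [BinTree.sizeAt_eq_zero hut])]
    simp

theorem isReferenceState_bstMatrix : IsReferenceState bstMatrix rootTree := by
  intro t
  rw [greenKernel_bstMatrix]
  exact ⟨ENNReal.ofReal_pos.2 (hitProb_pos (rootTree_subset t)), ENNReal.ofReal_lt_top⟩

/-! ### Doob transforms with respect to a positive function -/

section DoobTransform

variable {E : Type*} {P Q : E → E → ℝ} {h : E → ℝ}

/-- Along a path the factors `h(k) h(k)⁻¹` at intermediate states cancel, and only the endpoints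
remain. -/
theorem stepPow_of_doob (hP : ∀ i j, 0 ≤ P i j) (hpos : ∀ i, 0 < h i)
    (hQ : ∀ i j, Q i j = (h i)⁻¹ * P i j * h j) (n : ℕ) (i j : E) :
    stepPow Q n i j = ENNReal.ofReal (h i)⁻¹ * stepPow P n i j * ENNReal.ofReal (h j) := by
  have hinv : ∀ i, ENNReal.ofReal (h i) * ENNReal.ofReal (h i)⁻¹ = 1 := fun i => by
    rw [← ENNReal.ofReal_mul (hpos i).le, mul_inv_cancel₀ (hpos i).ne', ENNReal.ofReal_one]
  induction n generalizing i with
  | zero =>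
    by_cases hij : i = j
    · rw [stepPow, stepPow, if_pos hij, hij, mul_one, mul_comm, hinv]
    · rw [stepPow, stepPow, if_neg hij, mul_zero, zero_mul]
  | succ n ih =>
    rw [stepPow, stepPow, ← ENNReal.tsum_mul_left, ← ENNReal.tsum_mul_right]
    refine tsum_congr fun k => ?_
    have hi : 0 ≤ (h i)⁻¹ := (inv_pos.2 (hpos i)).le
    rw [ih, hQ, ENNReal.ofReal_mul (mul_nonneg hi (hP i k)), ENNReal.ofReal_mul hi]
    calc _ = ENNReal.ofReal (h i)⁻¹ * (ENNReal.ofReal (P i k) * stepPow P n k j)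
          * ENNReal.ofReal (h j) * (ENNReal.ofReal (h k) * ENNReal.ofReal (h k)⁻¹) := by ring
      _ = _ := by rw [hinv, mul_one]

theorem greenKernel_of_doob (hP : ∀ i j, 0 ≤ P i j) (hpos : ∀ i, 0 < h i)
    (hQ : ∀ i j, Q i j = (h i)⁻¹ * P i j * h j) (i j : E) :
    greenKernel Q i j = ENNReal.ofReal (h i)⁻¹ * greenKernel P i j * ENNReal.ofReal (h j) := by
  simp_rw [greenKernel, stepPow_of_doob hP hpos hQ, ENNReal.tsum_mul_right, ENNReal.tsum_mul_left]

theorem IsReferenceState.of_doob {e : E} (he : IsReferenceState P e) (hP : ∀ i j, 0 ≤ P i j)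
    (hpos : ∀ i, 0 < h i) (hQ : ∀ i j, Q i j = (h i)⁻¹ * P i j * h j) :
    IsReferenceState Q e := by
  intro j
  rw [greenKernel_of_doob hP hpos hQ]
  refine ⟨ENNReal.mul_pos (mul_ne_zero ?_ (he j).1.ne') ?_, ENNReal.mul_lt_top
    (ENNReal.mul_lt_top ENNReal.ofReal_lt_top (he j).2) ENNReal.ofReal_lt_top⟩
  · exact (ENNReal.ofReal_pos.2 (inv_pos.2 (hpos e))).ne'
  · exact (ENNReal.ofReal_pos.2 (hpos j)).ne'

theorem martinKernel_of_doob (hP : ∀ i j, 0 ≤ P i j) (hpos : ∀ i, 0 < h i)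
    (hQ : ∀ i j, Q i j = (h i)⁻¹ * P i j * h j) (e i j : E) :
    martinKernel Q e i j = h e / h i * martinKernel P e i j := by
  have hne : ∀ i, h i ≠ 0 := fun i => (hpos i).ne'
  rw [martinKernel, martinKernel, greenKernel_of_doob hP hpos hQ, greenKernel_of_doob hP hpos hQ]
  simp only [ENNReal.toReal_div, ENNReal.toReal_mul,
    ENNReal.toReal_ofReal (inv_pos.2 (hpos _)).le, ENNReal.toReal_ofReal (hpos j).le]
  rw [mul_div_mul_right _ _ (hne j), mul_div_mul_comm, inv_div_inv]

/-- A Doob transform with respect to a positive function does not change the Doob–Martin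
compactification. -/
theorem sameMartinCompactification_of_doob (hP : ∀ i j, 0 ≤ P i j) (hpos : ∀ i, 0 < h i)
    (hQ : ∀ i j, Q i j = (h i)⁻¹ * P i j * h j) (e : E) : SameMartinCompactification P Q e := by
  -- The factor `h e / h i` does not depend on `j`, so one coordinatewise scaling carries every
  -- kernel function of `P` to that of `Q`, and hence closure to closure.
  let Φ : (E → ℝ) ≃ₜ (E → ℝ) := Homeomorph.piCongrRight fun i =>
    Homeomorph.mulLeft₀ (h e / h i) (div_ne_zero (hpos e).ne' (hpos i).ne')
  have hΦ : ∀ j, Φ (fun i => martinKernel P e i j) = fun i => martinKernel Q e i j := fun j =>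
    funext fun i => (martinKernel_of_doob hP hpos hQ e i j).symm
  have himage : Φ '' martinCompactification P e = martinCompactification Q e := by
    rw [martinCompactification, Φ.image_closure, ← Set.range_comp]
    exact congrArg (fun f => closure (Set.range f)) (funext hΦ)
  refine ⟨Φ.sets (t := martinCompactification Q e) ?_, fun j => Subtype.ext (hΦ j)⟩
  rw [← himage, Φ.injective.preimage_image]

end DoobTransform

/-! ### The digital search tree process as a transform of the binary search tree process -/

theorem dstFun_pos (s : BinTree) : 0 < dstFun s := by
  unfold dstFun
  have : 0 < ∏ u ∈ s.verts, ((2 : ℝ) ^ u.length)⁻¹ := Finset.prod_pos fun u _ => by positivity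
  positivity

theorem dstFun_rootTree : dstFun rootTree = 1 := by
  simp [dstFun, BinTree.size, rootTree]

theorem dstFun_adjoin {s : BinTree} {v : List Bool} (hv : v ∈ s.external) :
    dstFun (s.adjoin v) = ((s.size : ℝ) + 1) * ((2 : ℝ) ^ v.length)⁻¹ * dstFun s := by
  rw [dstFun, dstFun, BinTree.size_adjoin hv, BinTree.verts_adjoin hv,
    Finset.prod_insert (BinTree.notMem_of_mem_external hv), Nat.factorial_succ]
  push_cast
  ring

theorem bstWeight_mul_dstFun_adjoin {s : BinTree} {v : List Bool} (hv : v ∈ s.external) :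
    bstWeight s v * dstFun (s.adjoin v) = dstFun s * dstWeight s v := by
  have : (s.size : ℝ) + 1 ≠ 0 := by positivity
  rw [dstFun_adjoin hv, bstWeight, dstWeight]
  field_simp

theorem dstMatrix_eq_doob (s t : BinTree) :
    dstMatrix s t = (dstFun s)⁻¹ * bstMatrix s t * dstFun t := by
  rw [dstMatrix_eq_growthMatrix, bstMatrix_eq_growthMatrix, growthMatrix, growthMatrix, mul_assoc,
    Finset.sum_mul, Finset.mul_sum]
  refine Finset.sum_congr rfl fun v hv => ?_
  obtain ⟨hv, hvt⟩ := Finset.mem_filter.1 hv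
  rw [← (BinTree.insert_eq_verts_iff hv).1 hvt, bstWeight_mul_dstFun_adjoin hv,
    inv_mul_cancel_left₀ (dstFun_pos s).ne']

theorem sum_dstWeight (s : BinTree) : ∑ v ∈ s.external, dstWeight s v = 1 :=
  s.sum_external_weight

theorem growthOp_bstWeight_dstFun (s : BinTree) : growthOp bstWeight dstFun s = dstFun s := by
  rw [growthOp, Finset.sum_congr rfl fun v hv => bstWeight_mul_dstFun_adjoin hv, ← Finset.mul_sum]
  rw [sum_dstWeight, mul_one]

theorem isTransitionMatrix_bstMatrix : IsTransitionMatrix bstMatrix := by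
  rw [bstMatrix_eq_growthMatrix]
  exact isTransitionMatrix_growthMatrix (fun s v => (bstWeight_pos s v).le) sum_bstWeight

theorem isTransitionMatrix_dstMatrix : IsTransitionMatrix dstMatrix := by
  rw [dstMatrix_eq_growthMatrix]
  exact isTransitionMatrix_growthMatrix (fun s v => (dstWeight_pos s v).le) sum_dstWeight

theorem isRegularFun_dstFun : IsRegularFun bstMatrix dstFun := by
  rw [bstMatrix_eq_growthMatrix, isRegularFun_growthMatrix_iff fun s v => (bstWeight_pos s v).le]
  exact ⟨fun s => (dstFun_pos s).le, growthOp_bstWeight_dstFun⟩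

theorem isReferenceState_dstMatrix : IsReferenceState dstMatrix rootTree :=
  isReferenceState_bstMatrix.of_doob isTransitionMatrix_bstMatrix.1 dstFun_pos dstMatrix_eq_doob

/-- Representation of a regular function of the binary search tree process by its values on the
trees with `n + 1` vertices, as an expectation for the digital search tree process. -/
theorem growthOp_iterate_martinKernel {f : BinTree → ℝ} (hf : IsRegularFun bstMatrix f) {n : ℕ}
    {s : BinTree} (hn : s.size ≤ n + 1) :
    (growthOp dstWeight)^[n] (fun t => martinKernel bstMatrix rootTree s t * (f t / dstFun t))
      rootTree = f s := by
  have hcb : ∀ s v, 0 ≤ bstWeight s v := fun s v => (bstWeight_pos s v).le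
  have hcd : ∀ s v, 0 ≤ dstWeight s v := fun s v => (dstWeight_pos s v).le
  obtain ⟨hf0, hf⟩ :=
    (isRegularFun_growthMatrix_iff hcb).1 (bstMatrix_eq_growthMatrix ▸ hf)
  have hF : ∀ t, 0 ≤ martinKernel bstMatrix rootTree s t * (f t / dstFun t) := fun t =>
    mul_nonneg ENNReal.toReal_nonneg (div_nonneg (hf0 t) (dstFun_pos t).le)
  rw [← ENNReal.ofReal_eq_ofReal_iff (growthOp_iterate_nonneg hcd hF _ _) (hf0 s),
    ← tsum_stepPow_growthMatrix hcd hF, ← dstMatrix_eq_growthMatrix]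
  -- The BST chain from `s` has `n + 1` vertices after `n + 1 - #s` steps; `hn` keeps this
  -- subtraction from truncating.
  have hright := tsum_stepPow_growthMatrix hcb hf0 (n + 1 - s.size) s
  rw [growthOp_iterate_of_fixed hf, ← bstMatrix_eq_growthMatrix] at hright
  rw [← hright]
  refine tsum_congr fun t => ?_
  rw [stepPow_of_doob isTransitionMatrix_bstMatrix.1 dstFun_pos dstMatrix_eq_doob,
    stepPow_bstMatrix, stepPow_bstMatrix, dstFun_rootTree, size_rootTree]
  -- For such `t`, the factor `h(t)` of the transform cancels the denominator in `f t / h t`, and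
  -- `K(s,t)` times the hitting probability from the root is that from `s`.
  by_cases ht : t.size = n + 1
  · rw [if_pos (by omega), if_pos (by omega), inv_one, ENNReal.ofReal_one, one_mul,
      ← ENNReal.ofReal_mul (hitProb_nonneg _ _), ← ENNReal.ofReal_mul
        (mul_nonneg (hitProb_nonneg _ _) (dstFun_pos _).le),
      ← ENNReal.ofReal_mul (hitProb_nonneg _ _), martinKernel, greenKernel_bstMatrix,
      greenKernel_bstMatrix, ENNReal.toReal_div, ENNReal.toReal_ofReal (hitProb_nonneg _ _),
      ENNReal.toReal_ofReal (hitProb_nonneg _ _)]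
    have h1 := (hitProb_pos (rootTree_subset t)).ne'
    have h2 := (dstFun_pos t).ne'
    congr 1
    field_simp
  · rw [if_neg (by omega), if_neg (by omega)]
    simp

/-! ### Subtree sizes of digital search trees -/

/-- The conditional probability `μ (cylinderAt u | cylinderAt v)` for the coin-tossing measure. -/
noncomputable def condMass (v u : List Bool) : ℝ :=
  (2 : ℝ) ^ v.length * coinMeasure.real (cylinderAt v ∩ cylinderAt u)

/-- The sum of `μ (cylinderAt u | cylinderAt v)` over the vertices `v` of the tree: a compensated
version of `sizeAt` whose drift under the digital search tree process is constant. -/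
noncomputable def condSize (u : List Bool) (t : BinTree) : ℝ := ∑ v ∈ t.verts, condMass v u

theorem condMass_nonneg (v u : List Bool) : 0 ≤ condMass v u := by
  unfold condMass; positivity

theorem condMass_le_one (v u : List Bool) : condMass v u ≤ 1 := by
  have h := measureReal_mono (μ := coinMeasure)
    (Set.inter_subset_left (s := cylinderAt v) (t := cylinderAt u))
  rw [coinMeasure_real_cylinderAt] at h
  have h2 : (0 : ℝ) < 2 ^ v.length := by positivity
  calc condMass v u ≤ 2 ^ v.length * ((2 : ℝ) ^ v.length)⁻¹ := mul_le_mul_of_nonneg_left h h2.le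
    _ = 1 := mul_inv_cancel₀ h2.ne'

theorem condMass_of_prefix {v u : List Bool} (h : u <+: v) : condMass v u = 1 := by
  rw [condMass, Set.inter_eq_left.2 (cylinderAt_subset h), coinMeasure_real_cylinderAt]
  exact mul_inv_cancel₀ (by positivity)

theorem condMass_eq_zero {v u : List Bool} (h : ¬ u <+: v) (h' : ¬ v <+: u) :
    condMass v u = 0 := by
  have : cylinderAt v ∩ cylinderAt u = ∅ := Set.eq_empty_of_forall_notMem fun x hx =>
    (prefix_or_prefix_of_mem_cylinderAt hx.1 hx.2).elim h' h
  rw [condMass, this, measureReal_empty, mul_zero]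

/-- Vertices extending `u` count one in both quantities. Of the others only initial segments of `u`
contribute to `condSize`: at most `|u| + 1` words, each with mass at most one. -/
theorem abs_sizeAt_sub_condSize_le (u : List Bool) (t : BinTree) :
    |(t.sizeAt u : ℝ) - condSize u t| ≤ u.length + 1 := by
  have hsplit := Finset.sum_filter_add_sum_filter_not t.verts (fun v => u <+: v)
    (fun v => condMass v u)
  have h1 : ∑ v ∈ t.verts.filter (fun v => u <+: v), condMass v u = t.sizeAt u := by
    rw [Finset.sum_congr rfl fun v hv => condMass_of_prefix (Finset.mem_filter.1 hv).2]
    simp [BinTree.sizeAt]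
  have h2 : ∑ v ∈ t.verts.filter (fun v => ¬ u <+: v), condMass v u ≤ u.length + 1 := by
    calc ∑ v ∈ t.verts.filter (fun v => ¬ u <+: v), condMass v u
        ≤ ∑ v ∈ t.verts.filter (fun v => ¬ u <+: v), if v ∈ u.inits.toFinset then 1 else 0 := by
          refine Finset.sum_le_sum fun v hv => ?_
          split_ifs with hvu
          · exact condMass_le_one v u
          · refine (condMass_eq_zero (Finset.mem_filter.1 hv).2 fun h => hvu ?_).le
            simpa using h
      _ ≤ u.inits.toFinset.card := by
          rw [Finset.sum_boole]
          exact_mod_cast Finset.card_le_card fun v hv => (Finset.mem_filter.1 hv).2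
      _ ≤ u.length + 1 := by
          have := List.toFinset_card_le u.inits
          rw [List.length_inits] at this
          exact_mod_cast this
  have h3 : 0 ≤ ∑ v ∈ t.verts.filter (fun v => ¬ u <+: v), condMass v u :=
    Finset.sum_nonneg fun v _ => condMass_nonneg v u
  rw [condSize, ← hsplit, h1, abs_le]
  constructor <;> linarith

theorem condSize_adjoin {s : BinTree} {v : List Bool} (hv : v ∈ s.external) (u : List Bool) :
    condSize u (s.adjoin v) = condSize u s + condMass v u := by
  rw [condSize, BinTree.verts_adjoin hv, Finset.sum_insert (BinTree.notMem_of_mem_external hv),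
    add_comm, condSize]

theorem sum_dstWeight_mul_condMass (s : BinTree) (u : List Bool) :
    ∑ v ∈ s.external, dstWeight s v * condMass v u = ((2 : ℝ) ^ u.length)⁻¹ := by
  rw [← s.sum_coinMeasure_inter u]
  refine Finset.sum_congr rfl fun v _ => ?_
  rw [dstWeight, condMass, inv_mul_cancel_left₀ (by positivity)]

/-- Under DST, `condSize u t - 2^{-|u|} #t` is a martingale with increments `condMass v u -
2^{-|u|}` of modulus at most one. The cross term averages to zero, so the mean square grows by at
most one per step. -/
theorem growthOp_sq_condSize_le (u : List Bool) (s : BinTree) :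
    growthOp dstWeight (fun t => (condSize u t - ((2 : ℝ) ^ u.length)⁻¹ * t.size) ^ 2) s ≤
      (condSize u s - ((2 : ℝ) ^ u.length)⁻¹ * s.size) ^ 2 + 1 := by
  set p : ℝ := ((2 : ℝ) ^ u.length)⁻¹ with hp
  set x : ℝ := condSize u s - p * s.size with hx
  have hp0 : 0 ≤ p := by positivity
  have hp1 : p ≤ 1 := inv_le_one_of_one_le₀ (one_le_pow₀ one_le_two)
  have hterm : ∀ v ∈ s.external,
      dstWeight s v * (condSize u (s.adjoin v) - p * (s.adjoin v).size) ^ 2 ≤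
        (x ^ 2 - 2 * x * p + 1) * dstWeight s v + 2 * x * (dstWeight s v * condMass v u) := by
    intro v hv
    rw [condSize_adjoin hv, BinTree.size_adjoin hv]
    push_cast
    have h0 := condMass_nonneg v u
    have h1 := condMass_le_one v u
    have hsq : (condMass v u - p) ^ 2 ≤ 1 := by
      rw [sq_le_one_iff_abs_le_one, abs_le]
      constructor <;> linarith
    calc _ = dstWeight s v * ((x ^ 2 - 2 * x * p + (condMass v u - p) ^ 2)
          + 2 * x * condMass v u) := by rw [hx]; ring
      _ ≤ dstWeight s v * ((x ^ 2 - 2 * x * p + 1) + 2 * x * condMass v u) :=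
          mul_le_mul_of_nonneg_left (by linarith) (dstWeight_pos s v).le
      _ = _ := by ring
  refine (Finset.sum_le_sum hterm).trans ?_
  rw [Finset.sum_add_distrib, ← Finset.mul_sum, ← Finset.mul_sum, sum_dstWeight,
    sum_dstWeight_mul_condMass, ← hp]
  linarith

theorem growthOp_iterate_le_add {c : BinTree → List Bool → ℝ} (hc : ∀ s v, 0 ≤ c s v)
    (hsum : ∀ s : BinTree, ∑ v ∈ s.external, c s v = 1) {F : BinTree → ℝ} {b : ℝ}
    (hF : ∀ s, growthOp c F s ≤ F s + b) (n : ℕ) (s : BinTree) :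
    (growthOp c)^[n] F s ≤ F s + n * b := by
  induction n generalizing s with
  | zero => simp
  | succ n ih =>
    rw [Function.iterate_succ_apply']
    have : growthOp c ((growthOp c)^[n] F) s ≤ growthOp c F s + n * b := by
      calc _ ≤ ∑ v ∈ s.external, c s v * (F (s.adjoin v) + n * b) :=
            Finset.sum_le_sum fun v _ => mul_le_mul_of_nonneg_left (ih _) (hc _ _)
        _ = _ := by simp_rw [mul_add, Finset.sum_add_distrib, ← Finset.sum_mul, hsum, one_mul]; rfl
    have := hF s
    push_cast
    linarith

theorem growthOp_iterate_sq_condSize_le (u : List Bool) (n : ℕ) :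
    (growthOp dstWeight)^[n] (fun t => (condSize u t - ((2 : ℝ) ^ u.length)⁻¹ * t.size) ^ 2)
      rootTree ≤ n := by
  have h0 : condSize u rootTree = ((2 : ℝ) ^ u.length)⁻¹ := by
    simp [condSize, rootTree, condMass, cylinderAt_nil, coinMeasure_real_cylinderAt]
  have h := growthOp_iterate_le_add (fun s v => (dstWeight_pos s v).le)
    sum_dstWeight (growthOp_sq_condSize_le u) n rootTree
  simpa [h0, size_rootTree] using h

/-- The relative subtree sizes of digital search trees converge in mean. -/
theorem growthOp_iterate_abs_sizeAt_le (u : List Bool) (n : ℕ) :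
    (growthOp dstWeight)^[n] (fun t => |(t.sizeAt u : ℝ) / t.size - ((2 : ℝ) ^ u.length)⁻¹|)
      rootTree ≤ (2 * √(n + 1 : ℕ) + u.length + 1) / (n + 1 : ℕ) := by
  have hc : ∀ s v, 0 ≤ dstWeight s v := fun s v => (dstWeight_pos s v).le
  set N : ℕ := n + 1 with hN
  set p : ℝ := ((2 : ℝ) ^ u.length)⁻¹
  have hNpos : (0 : ℝ) < N := by positivity
  have hr : 0 < √(N : ℝ) := Real.sqrt_pos.2 hNpos
  have hrr : √(N : ℝ) * √(N : ℝ) = N := Real.mul_self_sqrt hNpos.le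
  have hle : ∀ t : BinTree, t.size = rootTree.size + n → |(t.sizeAt u : ℝ) / t.size - p| ≤
      (√(N : ℝ) + u.length + 1) / N + (√(N : ℝ) * N)⁻¹ * (condSize u t - p * t.size) ^ 2 := by
    intro t ht
    have htN : (t.size : ℝ) = N := by rw [ht, size_rootTree, hN, add_comm]
    have h1 := abs_sizeAt_sub_condSize_le u t
    set x : ℝ := condSize u t - p * t.size with hx
    -- This pointwise bound replaces Cauchy–Schwarz and is linear in `x ^ 2`, whose mean is at most
    -- `n`; the scale `√N` balances the two terms.
    have h2 : |x| ≤ √(N : ℝ) + x ^ 2 / √(N : ℝ) := by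
      rw [← sub_le_iff_le_add', le_div_iff₀ hr, ← sq_abs x]
      nlinarith [sq_nonneg (|x| - √(N : ℝ)), abs_nonneg x]
    have h3 : |(t.sizeAt u : ℝ) / t.size - p| = |((t.sizeAt u : ℝ) - condSize u t) + x| / N := by
      have hx' : (t.sizeAt u : ℝ) / t.size - p = ((t.sizeAt u : ℝ) - condSize u t + x) / N := by
        rw [hx, htN]
        field_simp
        ring
      rw [hx', abs_div, abs_of_pos hNpos]
    have h4 := abs_add_le ((t.sizeAt u : ℝ) - condSize u t) x
    calc _ = |((t.sizeAt u : ℝ) - condSize u t) + x| / N := h3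
      _ ≤ (√(N : ℝ) + u.length + 1 + x ^ 2 / √(N : ℝ)) / N := by gcongr; linarith
      _ = _ := by field_simp
  refine (growthOp_iterate_mono hc hle).trans ?_
  rw [growthOp_iterate_add, growthOp_iterate_const sum_dstWeight,
    growthOp_iterate_const_mul]
  have h5 := growthOp_iterate_sq_condSize_le u n
  have h6 : (√(N : ℝ) * N)⁻¹ * (growthOp dstWeight)^[n]
      (fun t => (condSize u t - p * t.size) ^ 2) rootTree ≤ √(N : ℝ) / N := by
    have h7 : (n : ℝ) ≤ N := by rw [hN]; push_cast; linarith
    calc _ ≤ (√(N : ℝ) * N)⁻¹ * (√(N : ℝ) * √(N : ℝ)) := by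
          rw [hrr]
          exact mul_le_mul_of_nonneg_left (h5.trans h7) (by positivity)
      _ = _ := by field_simp
  calc _ ≤ (√(N : ℝ) + u.length + 1) / N + √(N : ℝ) / N := by gcongr
    _ = _ := by ring

/-! ### Convergence of the Martin kernel -/

theorem abs_prod_sub_prod_le {ι : Type*} (I : Finset ι) {a b : ι → ℝ}
    (ha : ∀ i, |a i| ≤ 1) (hb : ∀ i, |b i| ≤ 1) :
    |∏ i ∈ I, a i - ∏ i ∈ I, b i| ≤ ∑ i ∈ I, |a i - b i| := by
  classical
  induction I using Finset.induction_on with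
  | empty => simp
  | insert i I hi ih =>
    rw [Finset.prod_insert hi, Finset.prod_insert hi, Finset.sum_insert hi]
    have hA : |∏ i ∈ I, a i| ≤ 1 := by
      rw [Finset.abs_prod]
      exact Finset.prod_le_one (fun _ _ => abs_nonneg _) fun i _ => ha i
    calc _ = |(a i - b i) * ∏ i ∈ I, a i + b i * (∏ i ∈ I, a i - ∏ i ∈ I, b i)| := by ring_nf
      _ ≤ |a i - b i| * |∏ i ∈ I, a i| + |b i| * |∏ i ∈ I, a i - ∏ i ∈ I, b i| := by
          rw [← abs_mul, ← abs_mul]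
          exact abs_add_le _ _
      _ ≤ |a i - b i| * 1 + 1 * ∑ i ∈ I, |a i - b i| := by
          gcongr
          exact hb i
      _ = _ := by ring

/-- The correction factor between powers and falling factorials. -/
noncomputable def powDivDescFactorial (k n : ℕ) : ℝ := (n : ℝ) ^ k / n.descFactorial k

theorem tendsto_powDivDescFactorial (k : ℕ) :
    Tendsto (powDivDescFactorial k) atTop (𝓝 1) := by
  refine (Asymptotics.isEquivalent_iff_tendsto_one ?_).1 (isEquivalent_descFactorial k).symm
  filter_upwards [eventually_ge_atTop k] with n hn
  exact Nat.cast_ne_zero.2 (Nat.descFactorial_pos.2 hn).ne'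

theorem martinKernel_bstMatrix_eq_mul_prod (s t : BinTree) :
    martinKernel bstMatrix rootTree s t = (s.size)! * powDivDescFactorial s.size t.size *
      ∏ u ∈ s.verts, ((t.sizeAt u : ℝ) / t.size) := by
  have h : (t.size : ℝ) ≠ 0 := Nat.cast_ne_zero.2 t.size_pos.ne'
  rw [martinKernel_bstMatrix, powDivDescFactorial, Finset.prod_div_distrib, Finset.prod_const]
  change _ = _ * (_ / (t.size : ℝ) ^ s.size)
  field_simp

/-- The first error is linear in the fluctuations of the relative subtree sizes, so its mean can be
bounded term by term; the second depends on `t` only through `#t`, which is deterministic along the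
chain. -/
theorem abs_martinKernel_sub_dstFun_le (s t : BinTree) :
    |martinKernel bstMatrix rootTree s t - dstFun s| ≤
      (s.size)! * |powDivDescFactorial s.size t.size| *
        ∑ u ∈ s.verts, |(t.sizeAt u : ℝ) / t.size - ((2 : ℝ) ^ u.length)⁻¹| +
      (s.size)! * |powDivDescFactorial s.size t.size - 1| := by
  have ht : (0 : ℝ) < t.size := Nat.cast_pos.2 t.size_pos
  have ha : ∀ u, |(t.sizeAt u : ℝ) / t.size| ≤ 1 := fun u => by
    rw [abs_of_nonneg (by positivity), div_le_one ht]
    exact_mod_cast t.sizeAt_le_size u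
  have hb : ∀ u : List Bool, |((2 : ℝ) ^ u.length)⁻¹| ≤ 1 := fun u => by
    rw [abs_of_nonneg (by positivity)]
    exact inv_le_one_of_one_le₀ (one_le_pow₀ one_le_two)
  have hB : |∏ u ∈ s.verts, ((2 : ℝ) ^ u.length)⁻¹| ≤ 1 := by
    rw [Finset.abs_prod]
    exact Finset.prod_le_one (fun _ _ => abs_nonneg _) fun u _ => hb u
  have hf : (0 : ℝ) ≤ (s.size)! := Nat.cast_nonneg _
  rw [martinKernel_bstMatrix_eq_mul_prod, dstFun]
  set r := powDivDescFactorial s.size t.size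
  calc _ = |(s.size)! * r * (∏ u ∈ s.verts, ((t.sizeAt u : ℝ) / t.size) -
          ∏ u ∈ s.verts, ((2 : ℝ) ^ u.length)⁻¹) +
          (s.size)! * (r - 1) * ∏ u ∈ s.verts, ((2 : ℝ) ^ u.length)⁻¹| := by
        congr 1
        ring
    _ ≤ (s.size)! * |r| * |∏ u ∈ s.verts, ((t.sizeAt u : ℝ) / t.size) -
          ∏ u ∈ s.verts, ((2 : ℝ) ^ u.length)⁻¹| +
          (s.size)! * |r - 1| * |∏ u ∈ s.verts, ((2 : ℝ) ^ u.length)⁻¹| := by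
        refine (abs_add_le _ _).trans_eq ?_
        simp only [abs_mul, Nat.abs_cast]
    _ ≤ (s.size)! * |r| * (∑ u ∈ s.verts, |(t.sizeAt u : ℝ) / t.size - ((2 : ℝ) ^ u.length)⁻¹|) +
          (s.size)! * |r - 1| * 1 := by
        gcongr
        exact abs_prod_sub_prod_le _ ha hb
    _ = _ := by rw [mul_one]

/-- Along the digital search tree process, the Martin kernel of the binary search tree process
converges in mean to `dstFun`. -/
theorem tendsto_growthOp_iterate_abs_martinKernel (s : BinTree) :
    Tendsto (fun n => (growthOp dstWeight)^[n]
      (fun t => |martinKernel bstMatrix rootTree s t - dstFun s|) rootTree) atTop (𝓝 0) := by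
  have hc : ∀ s v, 0 ≤ dstWeight s v := fun s v => (dstWeight_pos s v).le
  set B : ℕ → ℝ := fun N => (s.size)! * |powDivDescFactorial s.size N| *
      ∑ u ∈ s.verts, (2 * √(N : ℝ) + u.length + 1) / N +
      (s.size)! * |powDivDescFactorial s.size N - 1| with hB
  have hbound : ∀ n, (growthOp dstWeight)^[n]
      (fun t => |martinKernel bstMatrix rootTree s t - dstFun s|) rootTree ≤ B (n + 1) := by
    intro n
    have hle : ∀ t : BinTree, t.size = rootTree.size + n →
        |martinKernel bstMatrix rootTree s t - dstFun s| ≤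
          (s.size)! * |powDivDescFactorial s.size (n + 1)| *
            ∑ u ∈ s.verts, |(t.sizeAt u : ℝ) / t.size - ((2 : ℝ) ^ u.length)⁻¹| +
          (s.size)! * |powDivDescFactorial s.size (n + 1) - 1| := by
      intro t ht
      have h := abs_martinKernel_sub_dstFun_le s t
      rwa [show powDivDescFactorial s.size t.size = powDivDescFactorial s.size (n + 1) by
        rw [ht, size_rootTree, add_comm]] at h
    refine (growthOp_iterate_mono hc hle).trans ?_
    rw [growthOp_iterate_add, growthOp_iterate_const sum_dstWeight,
      growthOp_iterate_const_mul, growthOp_iterate_sum, hB]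
    dsimp only
    gcongr with u
    exact growthOp_iterate_abs_sizeAt_le u n
  have hlim : Tendsto B atTop (𝓝 0) := by
    have hr := tendsto_powDivDescFactorial s.size
    have hinv : Tendsto (fun N : ℕ => (√(N : ℝ))⁻¹) atTop (𝓝 0) :=
      (Real.tendsto_sqrt_atTop.comp tendsto_natCast_atTop_atTop).inv_tendsto_atTop
    have hsum : Tendsto (fun N : ℕ => ∑ u ∈ s.verts, (2 * √(N : ℝ) + u.length + 1) / N) atTop
        (𝓝 0) := by
      have hzero : (0 : ℝ) = ∑ u ∈ s.verts, 0 := Finset.sum_const_zero.symm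
      rw [hzero]
      refine tendsto_finsetSum _ fun u _ => ?_
      have h := (hinv.const_mul 2).add
        (tendsto_const_div_atTop_nhds_zero_nat ((u.length : ℝ) + 1))
      rw [mul_zero, add_zero] at h
      refine h.congr fun N => ?_
      rw [add_assoc, add_div (2 * √(N : ℝ)), mul_div_assoc, Real.sqrt_div_self]
    have h := ((hr.abs.const_mul ((s.size)! : ℝ)).mul hsum).add
      ((hr.sub_const 1).abs.const_mul ((s.size)! : ℝ))
    simpa using h
  exact squeeze_zero (fun n => growthOp_iterate_nonneg hc (fun _ => abs_nonneg _) n _) hbound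
    (hlim.comp (tendsto_add_atTop_nat 1))

/-! ### Extremality -/

/-- With `g = f/h`, the representation at `s` and at the root gives `f(s) - h(s)` as the DST mean of
`(K(s, ·) - h(s)) g`. Since `0 ≤ g ≤ C`, convergence of the kernel in mean forces it to vanish. -/
theorem eq_dstFun_of_isRegularFun_of_le {f : BinTree → ℝ} (hf : IsRegularFun bstMatrix f)
    (hfe : f rootTree = 1) {C : ℝ} (hC : ∀ s, f s ≤ C * dstFun s) : f = dstFun := by
  have hc : ∀ s v, 0 ≤ dstWeight s v := fun s v => (dstWeight_pos s v).le
  funext s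
  set K := fun t => martinKernel bstMatrix rootTree s t
  set g := fun t => f t / dstFun t
  have hg0 : ∀ t, 0 ≤ g t := fun t => div_nonneg (hf.1 t) (dstFun_pos t).le
  have hgC : ∀ t, g t ≤ C := fun t => (div_le_iff₀ (dstFun_pos t)).2 (hC t)
  have hroot : ∀ t, martinKernel bstMatrix rootTree rootTree t = 1 := fun t =>
    ENNReal.toReal_eq_one_iff _ |>.2 (ENNReal.div_self (isReferenceState_bstMatrix t).1.ne'
      (isReferenceState_bstMatrix t).2.ne)
  have hbound : ∀ᶠ n in atTop, |f s - dstFun s| ≤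
      C * (growthOp dstWeight)^[n] (fun t => |K t - dstFun s|) rootTree := by
    filter_upwards [eventually_ge_atTop s.size] with n hn
    have h1 := growthOp_iterate_martinKernel hf (n := n) (s := s) (by omega)
    have h2 := growthOp_iterate_martinKernel hf (n := n) (s := rootTree)
      (by rw [size_rootTree]; omega)
    simp only [hroot, one_mul, hfe] at h2
    have hadd := growthOp_iterate_add (c := dstWeight) (fun t => (K t - dstFun s) * g t)
      (fun t => dstFun s * g t) n rootTree
    rw [growthOp_iterate_const_mul, h2, mul_one] at hadd
    have hfs : f s - dstFun s =
        (growthOp dstWeight)^[n] (fun t => (K t - dstFun s) * g t) rootTree := by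
      rw [sub_eq_iff_eq_add, ← hadd, ← h1]
      refine congrArg (fun F => (growthOp dstWeight)^[n] F rootTree) (funext fun t => ?_)
      change K t * g t = _
      ring
    rw [hfs, ← growthOp_iterate_const_mul]
    have hle : ∀ t, |(K t - dstFun s) * g t| ≤ C * |K t - dstFun s| := fun t => by
      rw [abs_mul, abs_of_nonneg (hg0 t), mul_comm]
      exact mul_le_mul_of_nonneg_right (hgC t) (abs_nonneg _)
    -- Monotonicity of the mean gives the two one-sided bounds separately.
    refine abs_le'.2 ⟨growthOp_iterate_mono hc fun t _ => (le_abs_self _).trans (hle t), ?_⟩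
    rw [← neg_one_mul, ← growthOp_iterate_const_mul]
    refine growthOp_iterate_mono hc fun t _ => ?_
    rw [neg_one_mul]
    exact (neg_le_abs _).trans (hle t)
  have hlim := (tendsto_growthOp_iterate_abs_martinKernel s).const_mul C
  rw [mul_zero] at hlim
  have h0 : |f s - dstFun s| ≤ 0 := ge_of_tendsto hlim hbound
  exact sub_eq_zero.1 (abs_nonpos_iff.1 h0)

/-- If `h = a f + b g` with `f`, `g` excessive, regularity of `h` forces equality in both excessive
inequalities. So `f` is regular, and `a f ≤ h` supplies the domination constant `a⁻¹`. -/
theorem isExtremalFun_dstFun : IsExtremalFun bstMatrix rootTree dstFun := by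
  have hc : ∀ s v, 0 ≤ bstWeight s v := fun s v => (bstWeight_pos s v).le
  rw [IsExtremalFun, mem_extremePoints_iff_left]
  refine ⟨⟨⟨isRegularFun_dstFun.1, fun s => (isRegularFun_dstFun.2 s).le⟩, dstFun_rootTree⟩, ?_⟩
  rintro f ⟨hf, hfe⟩ g ⟨hg, -⟩ ⟨a, b, ha, hb, -, hab⟩
  rw [bstMatrix_eq_growthMatrix, isExcessiveFun_growthMatrix_iff hc] at hf hg
  have hval : ∀ s, a * f s + b * g s = dstFun s := fun s => congrFun hab s
  have hop : ∀ s, a * growthOp bstWeight f s + b * growthOp bstWeight g s = dstFun s := by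
    intro s
    rw [← growthOp_bstWeight_dstFun s, growthOp, growthOp, growthOp, Finset.mul_sum,
      Finset.mul_sum, ← Finset.sum_add_distrib]
    refine Finset.sum_congr rfl fun v _ => ?_
    rw [← hval]
    ring
  refine eq_dstFun_of_isRegularFun_of_le (C := a⁻¹) ?_ hfe fun s => ?_
  · rw [bstMatrix_eq_growthMatrix, isRegularFun_growthMatrix_iff hc]
    refine ⟨hf.1, fun s => le_antisymm (hf.2 s) (le_of_mul_le_mul_left ?_ ha)⟩
    have := mul_le_mul_of_nonneg_left (hg.2 s) hb.le
    linarith [hval s, hop s]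
  · rw [← div_eq_inv_mul, le_div_iff₀ ha, mul_comm]
    have := mul_nonneg hb.le (hg.1 s)
    linarith [hval s]

/-! ### The boundary point -/

namespace BinTree

theorem exists_size_eq (n : ℕ) : ∃ s : BinTree, s.size = n + 1 := by
  induction n with
  | zero => exact ⟨rootTree, rfl⟩
  | succ n ih =>
    obtain ⟨s, hs⟩ := ih
    obtain ⟨v, hv⟩ : s.external.Nonempty := Finset.card_pos.1 (by rw [card_external]; omega)
    exact ⟨s.adjoin v, by rw [size_adjoin hv, hs]⟩

/-- The length bound keeps the children of `u` outside the tree, so that they are external. -/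
theorem exists_mem_verts (u : List Bool) :
    ∃ s : BinTree, u ∈ s.verts ∧ ∀ v ∈ s.verts, v.length ≤ u.length := by
  induction u using List.reverseRecOn with
  | nil => exact ⟨rootTree, by simp [rootTree], by simp [rootTree]⟩
  | append_singleton u b ih =>
    obtain ⟨s, hu, hs⟩ := ih
    have hext : u ++ [b] ∈ s.external :=
      mem_external.2 ⟨fun h => by simpa using hs _ h, u, hu, b, rfl⟩
    refine ⟨s.adjoin (u ++ [b]), by simp [verts_adjoin hext], fun v hv => ?_⟩
    rw [verts_adjoin hext, Finset.mem_insert] at hv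
    rcases hv with rfl | hv
    · rfl
    · exact (hs v hv).trans (by simp)

theorem exists_mem_external {u : List Bool} (hu : u ≠ []) : ∃ s : BinTree, u ∈ s.external := by
  obtain ⟨w, b, rfl⟩ := (List.eq_nil_or_concat u).resolve_left hu
  obtain ⟨s, hw, hs⟩ := exists_mem_verts w
  rw [List.concat_eq_append]
  exact ⟨s, mem_external.2 ⟨fun h => by simpa using hs _ h, w, hw, b, rfl⟩⟩

end BinTree

/-- For `#t < #s` the falling factorial is zero, and division by zero gives the closed form the
value zero. -/
theorem size_le_of_martinKernel_ne_zero {s t : BinTree}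
    (h : martinKernel bstMatrix rootTree s t ≠ 0) : s.size ≤ t.size := by
  by_contra! hlt
  rw [martinKernel_bstMatrix, Nat.descFactorial_of_lt hlt] at h
  simp at h

/-- First moment argument: a basic neighbourhood constrains finitely many coordinates `s`, to within
`ε s`. The deviations weighted by `(ε s)⁻¹` have a total DST mean below one at some time, so some
tree has total below one and meets every constraint. -/
theorem dstFun_mem_martinCompactification :
    dstFun ∈ martinCompactification bstMatrix rootTree := by
  have hc : ∀ s v, 0 ≤ dstWeight s v := fun s v => (dstWeight_pos s v).le
  rw [martinCompactification, mem_closure_iff_nhds]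
  intro U hU
  rw [nhds_pi, Filter.mem_pi'] at hU
  obtain ⟨I, V, hV, hVU⟩ := hU
  choose ε hε hball using fun s => Metric.mem_nhds_iff.1 (hV s)
  have hlim : Tendsto (fun n => (growthOp dstWeight)^[n] (fun t => ∑ s ∈ I,
      (ε s)⁻¹ * |martinKernel bstMatrix rootTree s t - dstFun s|) rootTree) atTop (𝓝 0) := by
    simp_rw [growthOp_iterate_sum, growthOp_iterate_const_mul]
    have h := tendsto_finsetSum I fun s _ =>
      (tendsto_growthOp_iterate_abs_martinKernel s).const_mul (ε s)⁻¹
    simpa using h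
  obtain ⟨n, hn⟩ := (hlim.eventually (gt_mem_nhds one_pos)).exists
  obtain ⟨t, ht⟩ : ∃ t, ∑ s ∈ I,
      (ε s)⁻¹ * |martinKernel bstMatrix rootTree s t - dstFun s| < 1 := by
    by_contra! hcon
    have := growthOp_iterate_mono hc (n := n) (s := rootTree) fun t _ => hcon t
    rw [growthOp_iterate_const sum_dstWeight] at this
    exact absurd hn this.not_gt
  refine ⟨_, hVU fun s hs => hball s ?_, t, rfl⟩
  have hle := Finset.single_le_sum (f := fun s =>
    (ε s)⁻¹ * |martinKernel bstMatrix rootTree s t - dstFun s|)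
    (fun s _ => mul_nonneg (inv_pos.2 (hε s)).le (abs_nonneg _)) hs
  rw [Metric.mem_ball, Real.dist_eq]
  have h := hle.trans_lt ht
  rwa [inv_mul_lt_iff₀ (hε s), mul_one] at h

/-- `h` is positive everywhere, whereas `K(·, t)` vanishes on trees larger than `t`. -/
theorem dstFun_mem_martinBoundary : dstFun ∈ martinBoundary bstMatrix rootTree := by
  refine ⟨dstFun_mem_martinCompactification, ?_⟩
  rintro ⟨t, ht⟩
  obtain ⟨s, hs⟩ := BinTree.exists_size_eq t.size
  have hst : martinKernel bstMatrix rootTree s t = dstFun s := congrFun ht s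
  have := size_le_of_martinKernel_ne_zero (hst ▸ (dstFun_pos s).ne')
  omega

theorem tendsto_size_of_tendsto_martinKernel {t : ℕ → BinTree}
    (h : ∀ s, Tendsto (fun n => martinKernel bstMatrix rootTree s (t n)) atTop (𝓝 (dstFun s))) :
    Tendsto (fun n => (t n).size) atTop atTop := by
  refine tendsto_atTop.2 fun m => ?_
  obtain ⟨s, hs⟩ := BinTree.exists_size_eq m
  filter_upwards [(h s).eventually_ne (dstFun_pos s).ne'] with n hn
  have := size_le_of_martinKernel_ne_zero hn
  omega

theorem tendsto_sizeAt_of_tendsto_martinKernel {t : ℕ → BinTree}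
    (h : ∀ s, Tendsto (fun n => martinKernel bstMatrix rootTree s (t n)) atTop (𝓝 (dstFun s)))
    (u : List Bool) : Tendsto (fun n => ((t n).sizeAt u : ℝ) / (t n).size) atTop
      (𝓝 ((2 : ℝ) ^ u.length)⁻¹) := by
  by_cases hu : u = []
  · subst hu
    refine tendsto_const_nhds.congr fun n => ?_
    have : ((t n).size : ℝ) ≠ 0 := Nat.cast_ne_zero.2 (t n).size_pos.ne'
    simp [BinTree.sizeAt_nil, this]
  obtain ⟨s, hs⟩ := BinTree.exists_mem_external hu
  have hsize := tendsto_size_of_tendsto_martinKernel h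
  have hr := (tendsto_powDivDescFactorial s.size).comp hsize
  have hr' := (tendsto_powDivDescFactorial (s.size + 1)).comp hsize
  have hs0 := (dstFun_pos s).ne'
  -- In `K(s ∪ {u}, t) / K(s, t)` all factors cancel except `#t(u)/#t`, the factor `#s + 1`, and a
  -- quotient of correction factors tending to one; the last two are divided out here.
  have hlim := (((h (s.adjoin u)).div (h s) hs0).mul (hr.div hr' one_ne_zero)).div_const
    ((s.size : ℝ) + 1)
  have hm : (s.size : ℝ) + 1 ≠ 0 := by positivity
  have hval : dstFun (s.adjoin u) / dstFun s * (1 / 1) / ((s.size : ℝ) + 1) =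
      ((2 : ℝ) ^ u.length)⁻¹ := by
    rw [dstFun_adjoin hs]
    field_simp
  rw [hval] at hlim
  refine hlim.congr' ?_
  filter_upwards [(h s).eventually_ne hs0, hr'.eventually_ne one_ne_zero] with n hn hn'
  simp only [Pi.div_apply, Function.comp_apply] at hn' ⊢
  rw [martinKernel_bstMatrix_eq_mul_prod] at hn
  rw [martinKernel_bstMatrix_eq_mul_prod, martinKernel_bstMatrix_eq_mul_prod,
    BinTree.size_adjoin hs, BinTree.verts_adjoin hs,
    Finset.prod_insert (BinTree.notMem_of_mem_external hs), Nat.factorial_succ]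
  have h1 := left_ne_zero_of_mul hn
  have h2 := right_ne_zero_of_mul hn
  have h3 := left_ne_zero_of_mul h1
  have h4 := right_ne_zero_of_mul h1
  push_cast
  field_simp

theorem tendsto_martinKernel_of_tendsto_sizeAt {t : ℕ → BinTree}
    (hsize : Tendsto (fun n => (t n).size) atTop atTop)
    (h : ∀ u, Tendsto (fun n => ((t n).sizeAt u : ℝ) / (t n).size) atTop
      (𝓝 ((2 : ℝ) ^ u.length)⁻¹)) (s : BinTree) :
    Tendsto (fun n => martinKernel bstMatrix rootTree s (t n)) atTop (𝓝 (dstFun s)) := by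
  simp_rw [martinKernel_bstMatrix_eq_mul_prod]
  have hlim := (((tendsto_powDivDescFactorial s.size).comp hsize).const_mul ((s.size)! : ℝ)).mul
    (tendsto_finsetProd s.verts fun u _ => h u)
  rwa [mul_one] at hlim

theorem isBSTBoundaryPoint_dstFun : IsBSTBoundaryPoint dstFun coinMeasure := by
  refine ⟨dstFun_mem_martinBoundary, fun t => ?_⟩
  simp_rw [coinMeasure_real_cylinderAt]
  rw [tendsto_pi_nhds]
  exact ⟨fun h => ⟨tendsto_size_of_tendsto_martinKernel h,
    tendsto_sizeAt_of_tendsto_martinKernel h⟩,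
    fun h => tendsto_martinKernel_of_tendsto_sizeAt h.1 h.2⟩

theorem theorem5p1 :
    -- both matrices are transition matrices with reference state the root tree
    (IsTransitionMatrix bstMatrix ∧ IsReferenceState bstMatrix rootTree) ∧
    (IsTransitionMatrix dstMatrix ∧ IsReferenceState dstMatrix rootTree) ∧
    -- the digital search tree process is a Markov chain with transition matrix `dstMatrix`
    (∀ (Ω : Type*) [MeasurableSpace Ω] (Pr : Measure Ω) [IsProbabilityMeasure Pr]
      (w : BinTree) (X : ℕ → Ω → BinTree), IsDSTProcess Pr w X → IsMarkovChain Pr X dstMatrix) ∧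
    -- `h` is regular and positive, and the transition matrix of the digital search tree process
    -- is that of the Doob `h`-transform of the binary search tree process
    IsRegularFun bstMatrix dstFun ∧
    (∃ hpos : ∀ s, 0 < dstFun s, ∀ s t,
      dstMatrix s t = doobTransform bstMatrix dstFun ⟨s, hpos s⟩ ⟨t, hpos t⟩) ∧
    -- `h` is extremal
    IsExtremalFun bstMatrix rootTree dstFun ∧
    -- `h = K(·, y)` for the boundary point `y` identified with the fair coin-tossing measure
    IsBSTBoundaryPoint dstFun coinMeasure ∧
    -- the two Doob–Martin compactifications coincide
    SameMartinCompactification bstMatrix dstMatrix rootTree := by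
  refine ⟨⟨isTransitionMatrix_bstMatrix, isReferenceState_bstMatrix⟩,
    ⟨isTransitionMatrix_dstMatrix, isReferenceState_dstMatrix⟩,
    fun _ _ _ _ _ _ h => h.isMarkovChain, isRegularFun_dstFun,
    ⟨dstFun_pos, fun s t => dstMatrix_eq_doob s t⟩, isExtremalFun_dstFun,
    isBSTBoundaryPoint_dstFun, ?_⟩
  exact sameMartinCompactification_of_doob isTransitionMatrix_bstMatrix.1 dstFun_pos
    dstMatrix_eq_doob rootTree
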